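/- Let $\Gamma_0^*(3)=\Gamma_0(3)\cup\Gamma_0(3)W_3\subset \mathrm{SL}_2(\mathbb R)$ with $W_3=\begin{pmatrix}0&-1/\sqrt3\\ \sqrt3&0\end{pmatrix}$. For an even integer $k$ let $M_{k,3}$ be the complex vector space of modular forms of weight $k$ for $\Gamma_0^*(3)$ (holomorphic on the upper half-plane $\mathbb H$ and at the cusps), and $M_{k,3}^0\subset M_{k,3}$ the subspace of cusp forms. For even $k\ge 4$ put $$E_k(z)=\frac12\sum_{(c,d)=1}(cz+d)^{-k},$$ let $E_0=1$, and for $k=0$ and even $k\geq 4$ put $$E^*_{k,3}(z)=\frac{3^{k/2}E_k(3z)+E_k(z)}{3^{k/2}+1}.$$ Define $$\Delta_{3,8}=\tfrac{41}{1728}\big((E^*_{4,3})^2-E^*_{8,3}\big),\qquad \Delta_{3,10}=\tfrac{61}{432}\big(E^*_{4,3}E^*_{6,3}-E^*_{10,3}\big),$$ $$\Delta^0_{3,12}=(\Delta_{3,8})^2/E^*_{4,3},\qquad \Delta^1_{3,12}=\Delta_{3,8}E^*_{4,3},\qquad \Delta_{3,14}=\Delta_{3,10}E^*_{4,3},$$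 where the quotient $\Delta^0_{3,12}$ is extended continuously to the zeros of $E^*_{4,3}$; the extension exists and satisfies $E^*_{4,3}\,\Delta^0_{3,12}=(\Delta_{3,8})^2$ on $\mathbb H$. Then, for even integers $k$: 1. For $k<0$ and for $k=2$, $M_{k,3}=0$. 2. For $k=0,4,6$, $M^0_{k,3}=0$ and $M_{k,3}$ is one-dimensional with basis $E^*_{k,3}$. 3. For $k=8,10,14$, $M^0_{k,3}=\mathbb C\,\Delta_{3,k}$ with $\Delta_{3,k}\ne 0$. 4. $M^0_{12,3}=\mathbb C\,\Delta^0_{3,12}\oplus\mathbb C\,\Delta^1_{3,12}$, and this space is two-dimensional. 5. For every even $k\notin\{8,10,14\}$, $M^0_{k,3}=M^0_{12,3}\cdot M_{k-12,3}$, the linear span of the products $fg$ with $f\in M^0_{12,3}$, $g\in M_{k-12,3}$. 6. For every even $k\ge 0$, $M_{k,3}$ is finite-dimensional, with $\dim M_{k,3}=\lfloor k/6\rfloor$ if $k\equiv 2,6\pmod{12}$ and $\dim M_{k,3}=\lfloor k/6\rfloor+1$ otherwise. -/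

import Mathlib

open UpperHalfPlane ModularForm CongruenceSubgroup Topology Filter
open scoped MatrixGroups

noncomputable section

namespace Fricke

/-- The Fricke involution `W_p = (0, -1/√p; √p, 0)`, an element of `SL₂(ℝ)`. -/
def W (p : ℕ) [NeZero p] : SL(2, ℝ) :=
  ⟨!![0, -1 / √(p : ℝ); √(p : ℝ), 0], by
    have h : √(p : ℝ) ≠ 0 :=
      Real.sqrt_ne_zero'.mpr (Nat.cast_pos.mpr (Nat.pos_of_ne_zero (NeZero.ne p)))
    rw [Matrix.det_fin_two_of]
    field_simp
    ring⟩

theorem coe_W (p : ℕ) [NeZero p] :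
    (W p : Matrix (Fin 2) (Fin 2) ℝ) = !![0, -1 / √(p : ℝ); √(p : ℝ), 0] := rfl

/-- `W_p² = -1`. -/
theorem W_mul_W (p : ℕ) [NeZero p] : W p * W p = -1 := by
  have h : √(p : ℝ) ≠ 0 :=
    Real.sqrt_ne_zero'.mpr (Nat.cast_pos.mpr (Nat.pos_of_ne_zero (NeZero.ne p)))
  ext i j
  rw [Matrix.SpecialLinearGroup.coe_mul, coe_W]
  fin_cases i <;> fin_cases j <;>
    simp [Matrix.mul_apply, Fin.sum_univ_two, neg_div, h]

/-- `W_p` normalizes `Γ₀(p)`: for `γ ∈ Γ₀(p)`, `W_p γ = γ' W_p` with `γ' ∈ Γ₀(p)`. -/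
theorem W_mul_Gamma0 (p : ℕ) [NeZero p] {γ : SL(2, ℤ)} (hγ : γ ∈ Gamma0 p) :
    ∃ γ' ∈ Gamma0 p, W p * Matrix.SpecialLinearGroup.map (Int.castRingHom ℝ) γ =
      Matrix.SpecialLinearGroup.map (Int.castRingHom ℝ) γ' * W p := by
  have hp : (0 : ℝ) < p := Nat.cast_pos.mpr (Nat.pos_of_ne_zero (NeZero.ne p))
  have h : √(p : ℝ) ≠ 0 := Real.sqrt_ne_zero'.mpr hp
  have hs : √(p : ℝ) ^ 2 = p := Real.sq_sqrt hp.le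
  rw [Gamma0_mem, ZMod.intCast_zmod_eq_zero_iff_dvd] at hγ
  obtain ⟨c, hc⟩ := hγ
  have hdet : γ 0 0 * γ 1 1 - γ 0 1 * γ 1 0 = 1 := by
    have := γ.det_coe
    rwa [Matrix.det_fin_two] at this
  have hdet' : (!![γ 1 1, -c; -(p * γ 0 1), γ 0 0] : Matrix (Fin 2) (Fin 2) ℤ).det = 1 := by
    rw [Matrix.det_fin_two_of]
    rw [hc] at hdet
    linarith
  obtain ⟨δ, hδ⟩ : ∃ δ : SL(2, ℤ), (δ : Matrix (Fin 2) (Fin 2) ℤ) =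
      !![γ 1 1, -c; -(p * γ 0 1), γ 0 0] := ⟨⟨_, hdet'⟩, rfl⟩
  refine ⟨δ, ?_, ?_⟩
  · rw [Gamma0_mem, hδ]
    simp
  · have hc' : ((γ 1 0 : ℤ) : ℝ) = p * c := by rw [hc]; push_cast; ring
    ext i j
    rw [Matrix.SpecialLinearGroup.coe_mul, Matrix.SpecialLinearGroup.coe_mul, coe_W,
      Matrix.SpecialLinearGroup.map_apply_coe, Matrix.SpecialLinearGroup.map_apply_coe, hδ]
    fin_cases i <;> fin_cases j <;>
      simp [Matrix.mul_apply, Fin.sum_univ_two, hc'] <;> field_simp <;> simp [hs, mul_comm]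

/-- The Fricke group `Γ₀*(p) = Γ₀(p) ∪ Γ₀(p) W_p`, as a subgroup of `SL₂(ℝ)`. -/
def Gamma0StarSL (p : ℕ) [NeZero p] : Subgroup SL(2, ℝ) where
  carrier := {g | ∃ γ ∈ Gamma0 p, g = Matrix.SpecialLinearGroup.map (Int.castRingHom ℝ) γ ∨
    g = Matrix.SpecialLinearGroup.map (Int.castRingHom ℝ) γ * W p}
  one_mem' := ⟨1, one_mem _, Or.inl (by simp)⟩
  mul_mem' := by
    have hneg : (-1 : SL(2, ℤ)) ∈ Gamma0 p := by rw [Gamma0_mem]; simp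
    have hneg' : Matrix.SpecialLinearGroup.map (Int.castRingHom ℝ) (-1 : SL(2, ℤ)) = -1 := by
      ext i j
      fin_cases i <;> fin_cases j <;> simp
    rintro _ _ ⟨γ, hγ, rfl | rfl⟩ ⟨δ, hδ, rfl | rfl⟩
    · exact ⟨γ * δ, mul_mem hγ hδ, Or.inl (by rw [map_mul])⟩
    · exact ⟨γ * δ, mul_mem hγ hδ, Or.inr (by rw [map_mul, mul_assoc])⟩
    · obtain ⟨δ', hδ', e⟩ := W_mul_Gamma0 p hδ
      exact ⟨γ * δ', mul_mem hγ hδ', Or.inr (by rw [map_mul, mul_assoc, e, mul_assoc])⟩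
    · obtain ⟨δ', hδ', e⟩ := W_mul_Gamma0 p hδ
      refine ⟨γ * δ' * (-1), mul_mem (mul_mem hγ hδ') hneg, Or.inl ?_⟩
      rw [map_mul, map_mul, hneg', mul_assoc, ← mul_assoc (W p), e, mul_assoc _ (W p), W_mul_W,
        mul_assoc]
  inv_mem' := by
    have hneg : (-1 : SL(2, ℤ)) ∈ Gamma0 p := by rw [Gamma0_mem]; simp
    have hneg' : Matrix.SpecialLinearGroup.map (Int.castRingHom ℝ) (-1 : SL(2, ℤ)) = -1 := by
      ext i j
      fin_cases i <;> fin_cases j <;> simp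
    rintro _ ⟨γ, hγ, rfl | rfl⟩
    · exact ⟨γ⁻¹, inv_mem hγ, Or.inl (by rw [map_inv])⟩
    · obtain ⟨δ, hδ, e⟩ := W_mul_Gamma0 p (inv_mem hγ)
      refine ⟨-1 * δ, mul_mem hneg hδ, Or.inr ?_⟩
      rw [map_mul, hneg', mul_assoc, ← e, ← W_mul_W p, map_inv, inv_eq_iff_mul_eq_one]
      have h4 : W p * W p * (W p * W p) = 1 := by rw [W_mul_W]; simp
      calc Matrix.SpecialLinearGroup.map (Int.castRingHom ℝ) γ * W p *
            (W p * W p * (W p * (Matrix.SpecialLinearGroup.map (Int.castRingHom ℝ) γ)⁻¹))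
          = Matrix.SpecialLinearGroup.map (Int.castRingHom ℝ) γ * (W p * W p * (W p * W p)) *
            (Matrix.SpecialLinearGroup.map (Int.castRingHom ℝ) γ)⁻¹ := by
            simp only [mul_assoc]
        _ = 1 := by rw [h4, mul_one, mul_inv_cancel]

/-- The Fricke group `Γ₀*(p)` as a subgroup of `GL₂(ℝ)`. -/
def Gamma0Star (p : ℕ) [NeZero p] : Subgroup (GL (Fin 2) ℝ) :=
  (Gamma0StarSL p).map Matrix.SpecialLinearGroup.toGL

instance (p : ℕ) [NeZero p] : (Gamma0Star p).HasDetOne where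
  det_eq := by
    rintro _ ⟨g, -, rfl⟩
    simp

/-- `M_{k,p}`: the space of modular forms of weight `k` for `Γ₀*(p)`, as a space of functions on
the upper half-plane. -/
def M (k : ℤ) (p : ℕ) [NeZero p] : Submodule ℂ (ℍ → ℂ) where
  carrier := {f | ∃ F : ModularForm (Gamma0Star p) k, ⇑F = f}
  zero_mem' := ⟨0, rfl⟩
  add_mem' := by
    rintro _ _ ⟨F, rfl⟩ ⟨G, rfl⟩
    exact ⟨F + G, rfl⟩
  smul_mem' := by
    rintro c _ ⟨F, rfl⟩
    exact ⟨c • F, rfl⟩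

/-- `M⁰_{k,p}`: the space of cusp forms of weight `k` for `Γ₀*(p)`, as a space of functions on
the upper half-plane. -/
def M0 (k : ℤ) (p : ℕ) [NeZero p] : Submodule ℂ (ℍ → ℂ) where
  carrier := {f | ∃ F : CuspForm (Gamma0Star p) k, ⇑F = f}
  zero_mem' := ⟨0, rfl⟩
  add_mem' := by
    rintro _ _ ⟨F, rfl⟩ ⟨G, rfl⟩
    exact ⟨F + G, rfl⟩
  smul_mem' := by
    rintro c _ ⟨F, rfl⟩
    exact ⟨c • F, rfl⟩

/-- The Eisenstein series `E_k(z) = 1/2 ∑_{(c,d)=1} (c z + d)^{-k}` for `SL₂(ℤ)` (meant for even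
`k ≥ 4`, where the series converges absolutely), with the usual convention `E_0 = 1`. -/
def Eis (k : ℤ) (z : ℍ) : ℂ :=
  if k = 0 then 1 else 1 / 2 * eisensteinSeries (0 : Fin 2 → ZMod 1) k z

/-- The point `p z` of the upper half-plane. -/
def scale (p : ℕ) [NeZero p] (z : ℍ) : ℍ :=
  ⟨(p : ℂ) * z, by
    have hp : (0 : ℝ) < p := Nat.cast_pos.mpr (Nat.pos_of_ne_zero (NeZero.ne p))
    simpa using mul_pos hp z.im_pos⟩

/-- The Eisenstein series `E*_{k,p}(z) = (p^{k/2} E_k(p z) + E_k(z)) / (p^{k/2} + 1)` for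
`Γ₀*(p)`; here `k` is meant to be even, so that the integer division `k / 2` is exact. -/
def Estar (k : ℤ) (p : ℕ) [NeZero p] (z : ℍ) : ℂ :=
  1 / ((p : ℂ) ^ (k / 2) + 1) * ((p : ℂ) ^ (k / 2) * Eis k (scale p z) + Eis k z)

/-- `Δ_{3,8} = 41/1728 ((E*_{4,3})² - E*_{8,3})`. -/
def Delta8 : ℍ → ℂ := (41 / 1728 : ℂ) • (Estar 4 3 ^ 2 - Estar 8 3)

/-- `Δ_{3,10} = 61/432 (E*_{4,3} E*_{6,3} - E*_{10,3})`. -/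
def Delta10 : ℍ → ℂ := (61 / 432 : ℂ) • (Estar 4 3 * Estar 6 3 - Estar 10 3)

/-- `Δ⁰_{3,12} = (Δ_{3,8})² / E*_{4,3}`, a quotient of holomorphic functions. Its values at the
zeros of `E*_{4,3}` (where pointwise division is meaningless) are given by continuous extension. -/
def Delta12_0 : ℍ → ℂ := fun z ↦ limUnder (𝓝[≠] z) fun w ↦ Delta8 w ^ 2 / Estar 4 3 w

/-- `Δ¹_{3,12} = Δ_{3,8} E*_{4,3}`. -/
def Delta12_1 : ℍ → ℂ := Delta8 * Estar 4 3

/-- `Δ_{3,14} = Δ_{3,10} E*_{4,3}`. -/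
def Delta14 : ℍ → ℂ := Delta10 * Estar 4 3

end Fricke

end

noncomputable section

namespace Fricke

open scoped Manifold
open Matrix.SpecialLinearGroup OnePoint

/-! ### The group `Gamma0Star p`: arithmeticity, translations and cusps. -/

section Group

variable {p : ℕ} [NeZero p]

/-! Division by nowhere vanishing forms takes the place of the valence formula. Since `Gamma0Star 3`
has one cusp, modularity is holomorphy, invariance and boundedness at infinity, and cuspidality is
the vanishing of one Fourier coefficient. The form `discMul`, Δ(3z)Δ(z), has weight 24, no zero on ℍ
and order exactly 4 at infinity. If f has weight k and order at least m, and mn = 4, then f^n /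
`discMul` is a form of weight nk - 24. It vanishes when this weight is negative and is constant when
it is 0. This kills forms of order at least 2 in weight below 12 and cusp forms in weight below 6;
in weight 6 a forced zero at the fixed point of W₃ completes the argument
(`eq_zero_of_coeff_zero_of_le_six`). Weight 2 is excluded by comparing the square and the cube of a
form with Eisenstein series.

The same bound proves `Delta8_pow_four`: Δ₈⁴ equals (E₄*)² times `discMul`. As `discMul` is the
square of the eta product `etaMulPow`, the identity theorem gives Δ₈² = ±E₄* `etaMulPow`. Hence
`Delta12_0` is holomorphic, has weight 12, vanishes nowhere on ℍ and has order exactly 2 at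
infinity. Every form whose first two coefficients vanish is therefore `Delta12_0` times a form of
weight k - 12 (`exists_eq_Delta12_0_mul`). Adding one form starting with 1 and one starting with q
gives, for even k ≥ 8, a splitting of M_k into two lines and `Delta12_0` · M_{k-12}; the cusp spaces
and the dimension formula follow. -/

theorem mem_Gamma0Star_iff {g : GL (Fin 2) ℝ} :
    g ∈ Gamma0Star p ↔ ∃ γ ∈ Gamma0 p, g = mapGL ℝ γ ∨ g = mapGL ℝ γ * toGL (W p) := by
  constructor
  · rintro ⟨_, ⟨γ, hγ, rfl | rfl⟩, rfl⟩
    · exact ⟨γ, hγ, Or.inl rfl⟩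
    · exact ⟨γ, hγ, Or.inr (map_mul _ _ _)⟩
  · rintro ⟨γ, hγ, rfl | rfl⟩
    · exact ⟨_, ⟨γ, hγ, Or.inl rfl⟩, rfl⟩
    · exact ⟨_, ⟨γ, hγ, Or.inr rfl⟩, map_mul _ _ _⟩

theorem toGL_W_mem : toGL (W p) ∈ Gamma0Star p :=
  mem_Gamma0Star_iff.mpr ⟨1, one_mem _, Or.inr (by simp)⟩

theorem Gamma0_le_Gamma0Star : (Gamma0 p : Subgroup (GL (Fin 2) ℝ)) ≤ Gamma0Star p := by
  rintro _ ⟨γ, hγ, rfl⟩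
  exact mem_Gamma0Star_iff.mpr ⟨γ, hγ, Or.inl rfl⟩

theorem relIndex_Gamma0_Gamma0Star_ne_zero :
    (Gamma0 p : Subgroup (GL (Fin 2) ℝ)).relIndex (Gamma0Star p) ≠ 0 := by
  by_cases hW : toGL (W p) ∈ (Gamma0 p : Subgroup (GL (Fin 2) ℝ))
  · rw [Subgroup.relIndex_eq_one.mpr]
    · exact one_ne_zero
    · intro g hg
      obtain ⟨γ, hγ, rfl | rfl⟩ := mem_Gamma0Star_iff.mp hg
      · exact ⟨γ, hγ, rfl⟩
      · exact mul_mem ⟨γ, hγ, rfl⟩ hW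
  · rw [Subgroup.relIndex_eq_two_iff_exists_notMem_and.mpr]
    · exact two_ne_zero
    · refine ⟨toGL (W p), toGL_W_mem, hW, fun g hg ↦ ?_⟩
      obtain ⟨γ, hγ, rfl | rfl⟩ := mem_Gamma0Star_iff.mp hg
      · exact Or.inr ⟨γ, hγ, rfl⟩
      -- Since W² = -1, the product γW · W is -γ, which lies in `Gamma0 p` again.
      · refine Or.inl ⟨γ * (-1), mul_mem hγ (by rw [Gamma0_mem]; simp), ?_⟩
        rw [mul_assoc, ← map_mul, W_mul_W, map_mul]
        congr 1
        ext i j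
        fin_cases i <;> fin_cases j <;> simp

instance : (Gamma0Star p).IsArithmetic where
  is_commensurable := by
    have h : Subgroup.Commensurable (Gamma0 p : Subgroup (GL (Fin 2) ℝ)) (Gamma0Star p) :=
      ⟨relIndex_Gamma0_Gamma0Star_ne_zero, by
        rw [Subgroup.relIndex_eq_one.mpr Gamma0_le_Gamma0Star]; exact one_ne_zero⟩
    exact h.symm.trans Subgroup.IsArithmetic.is_commensurable

theorem one_mem_strictPeriods : (1 : ℝ) ∈ (Gamma0Star p).strictPeriods := by
  rw [Subgroup.mem_strictPeriods_iff]
  apply Gamma0_le_Gamma0Star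
  rw [← Subgroup.mem_strictPeriods_iff]
  simp

/-- For prime `p`, the group `Γ₀*(p)` has a single cusp. -/
theorem exists_smul_infty_eq [Fact p.Prime] {c : OnePoint ℝ} (hc : IsCusp c (Gamma0Star p)) :
    ∃ g ∈ Gamma0Star p, g • ∞ = c := by
  rw [Subgroup.IsArithmetic.isCusp_iff_isCusp_SL2Z, isCusp_SL2Z_iff'] at hc
  obtain ⟨γ, rfl⟩ := hc
  by_cases hp : (p : ℤ) ∣ γ 1 0
  · exact ⟨_, mem_Gamma0Star_iff.mpr ⟨γ, by
      rwa [Gamma0_mem, ZMod.intCast_zmod_eq_zero_iff_dvd], Or.inl rfl⟩, rfl⟩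
  have hdet : γ 0 0 * γ 1 1 - γ 0 1 * γ 1 0 = 1 := by
    have := γ.det_coe
    rwa [Matrix.det_fin_two] at this
  have hcop : IsCoprime (γ 1 0) ((p : ℤ) * γ 0 0) := by
    refine IsCoprime.mul_right ?_ ⟨-γ 0 1, γ 1 1, by linarith⟩
    exact ((Nat.prime_iff_prime_int.mp Fact.out).coprime_iff_not_dvd.mpr hp).symm
  obtain ⟨x, y, hxy⟩ := hcop
  -- W sends ∞ to 0, so a matrix of `Gamma0 p` whose second column is the first column of γ sends W∞
  -- to the cusp γ∞. The Bézout relation supplies its first column.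
  have hdet' : (!![x, γ 0 0; -(p * y), γ 1 0] : Matrix (Fin 2) (Fin 2) ℤ).det = 1 := by
    rw [Matrix.det_fin_two_of]
    linarith
  obtain ⟨δ, hδ⟩ : ∃ δ : SL(2, ℤ), (δ : Matrix (Fin 2) (Fin 2) ℤ) =
      !![x, γ 0 0; -(p * y), γ 1 0] := ⟨⟨_, hdet'⟩, rfl⟩
  refine ⟨_, mem_Gamma0Star_iff.mpr ⟨δ, ?_, Or.inr rfl⟩, ?_⟩
  · rw [Gamma0_mem, hδ]
    simp
  · have h : √(p : ℝ) ≠ 0 :=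
      Real.sqrt_ne_zero'.mpr (Nat.cast_pos.mpr (Nat.pos_of_ne_zero (NeZero.ne p)))
    have h0 : γ 1 0 ≠ 0 := fun h ↦ hp (h ▸ dvd_zero _)
    simp [smul_infty_eq_ite, Matrix.mul_apply, Fin.sum_univ_two, hδ, coe_W, h, h0]
    rw [mul_div_mul_right _ _ h]

end Group

/-! ### The slash action of `Gamma0Star p`, whose elements have determinant one. -/

section Slash

variable {p : ℕ} [NeZero p] {k : ℤ}

theorem slash_apply_of_mem {g : GL (Fin 2) ℝ} (hg : g ∈ Gamma0Star p) (f : ℍ → ℂ) (z : ℍ) :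
    (f ∣[k] g) z = f (g • z) * denom g z ^ (-k) := by
  have h1 : g.det = 1 := Subgroup.HasDetOne.det_eq hg
  simp [slash_apply, h1, σ]

theorem slash_mul_of_mem {g : GL (Fin 2) ℝ} (hg : g ∈ Gamma0Star p) (k l : ℤ) (f h : ℍ → ℂ) :
    (f * h) ∣[k + l] g = f ∣[k] g * h ∣[l] g := by
  have h1 : g.det = 1 := Subgroup.HasDetOne.det_eq hg
  simp [mul_slash, h1]

theorem slash_div_of_mem {g : GL (Fin 2) ℝ} (hg : g ∈ Gamma0Star p) (k l : ℤ) (f h : ℍ → ℂ) :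
    (f / h) ∣[k - l] g = f ∣[k] g / h ∣[l] g := by
  ext z
  have := denom_ne_zero g z
  simp only [slash_apply_of_mem hg, Pi.div_apply, neg_sub, zpow_sub₀ this, zpow_neg]
  field_simp

theorem slash_eq_of_forall_Gamma0 {f : ℍ → ℂ} (hγ : ∀ γ ∈ Gamma0 p, f ∣[k] γ = f)
    (hW : f ∣[k] toGL (W p) = f) {g : GL (Fin 2) ℝ} (hg : g ∈ Gamma0Star p) :
    f ∣[k] g = f := by
  obtain ⟨γ, hγ', rfl | rfl⟩ := mem_Gamma0Star_iff.mp hg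
  · exact hγ γ hγ'
  · rw [SlashAction.slash_mul, show f ∣[k] mapGL ℝ γ = f from hγ γ hγ', hW]

end Slash

/-! ### Membership criteria and q-expansions. -/

section Membership

variable {p : ℕ} [NeZero p] {k l m : ℤ} {f g : ℍ → ℂ}

/-- Every cusp is g∞ with g in the group, and f slashed by g is f, so the bound at ∞ carries over to
all cusps. -/
theorem mem_M_iff [Fact p.Prime] : f ∈ M k p ↔ MDiff f ∧
    (∀ g ∈ Gamma0Star p, f ∣[k] g = f) ∧ IsBoundedAtImInfty f := by
  constructor
  · rintro ⟨F, rfl⟩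
    exact ⟨F.holo', F.slash_action_eq', isBoundedAt_infty_iff.mp <| F.bdd_at_cusps' <|
      (Gamma0Star p).isCusp_of_mem_strictPeriods one_pos one_mem_strictPeriods⟩
  · rintro ⟨h1, h2, h3⟩
    refine ⟨⟨⟨f, h2⟩, h1, fun {c} hc ↦ ?_⟩, rfl⟩
    obtain ⟨g, hg, rfl⟩ := exists_smul_infty_eq hc
    rw [isBoundedAt_iff rfl]
    exact (h2 g hg).symm ▸ h3

theorem mem_M0_iff [Fact p.Prime] : f ∈ M0 k p ↔ f ∈ M k p ∧ IsZeroAtImInfty f := by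
  constructor
  · rintro ⟨F, rfl⟩
    exact ⟨⟨F, rfl⟩, isZeroAt_infty_iff.mp <| F.zero_at_cusps' <|
      (Gamma0Star p).isCusp_of_mem_strictPeriods one_pos one_mem_strictPeriods⟩
  · rintro ⟨⟨F, rfl⟩, h3⟩
    refine ⟨⟨⟨F, F.slash_action_eq'⟩, F.holo', fun {c} hc ↦ ?_⟩, rfl⟩
    obtain ⟨g, hg, rfl⟩ := exists_smul_infty_eq hc
    rw [isZeroAt_iff rfl]
    exact (F.slash_action_eq' g hg).symm ▸ h3

theorem mul_mem_M (hf : f ∈ M k p) (hg : g ∈ M l p) (h : k + l = m) : f * g ∈ M m p := by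
  obtain ⟨F, rfl⟩ := hf
  obtain ⟨G, rfl⟩ := hg
  subst h
  exact ⟨F.mul G, rfl⟩

theorem pow_mem_M (hf : f ∈ M k p) (n : ℕ) (h : n * k = m) : f ^ n ∈ M m p := by
  obtain ⟨F, rfl⟩ := hf
  subst h
  exact ⟨F.pow n, F.coe_pow n⟩

theorem one_mem_M : (1 : ℍ → ℂ) ∈ M 0 p := ⟨1, rfl⟩

theorem eq_zero_of_neg_weight (hk : k < 0) (hf : f ∈ M k p) : f = 0 := by
  obtain ⟨F, rfl⟩ := hf
  rw [ModularForm.isZero_of_neg_weight hk F]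
  rfl

theorem eq_const_of_weight_zero (hf : f ∈ M 0 p) : ∃ c : ℂ, f = c • 1 := by
  obtain ⟨F, rfl⟩ := hf
  obtain ⟨c, hc⟩ := ModularForm.eq_const_of_weight_zero F
  exact ⟨c, by rw [hc]; ext; simp⟩

theorem mdifferentiable_of_mem_M (hf : f ∈ M k p) : MDiff f := by
  obtain ⟨F, rfl⟩ := hf
  exact F.holo'

theorem analyticAt_cuspFunction_of_mem_M (hf : f ∈ M k p) :
    AnalyticAt ℂ (cuspFunction 1 f) 0 := by
  obtain ⟨F, rfl⟩ := hf
  exact ModularFormClass.analyticAt_cuspFunction_zero F one_pos one_mem_strictPeriods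

theorem periodic_of_mem_M (hf : f ∈ M k p) : Function.Periodic (f ∘ ofComplex) (1 : ℝ) := by
  obtain ⟨F, rfl⟩ := hf
  exact SlashInvariantFormClass.periodic_comp_ofComplex F one_mem_strictPeriods

theorem qExpansion_mul_of_mem_M (hf : f ∈ M k p) (hg : g ∈ M l p) :
    qExpansion 1 (f * g) = qExpansion 1 f * qExpansion 1 g :=
  qExpansion_mul (analyticAt_cuspFunction_of_mem_M hf) (analyticAt_cuspFunction_of_mem_M hg)

theorem qExpansion_pow_of_mem_M (hf : f ∈ M k p) (n : ℕ) :
    qExpansion 1 (f ^ n) = qExpansion 1 f ^ n := by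
  induction n with
  | zero => simp [qExpansion_one]
  | succ n ih =>
    rw [pow_succ, pow_succ, qExpansion_mul_of_mem_M (pow_mem_M hf n rfl) hf, ih]

theorem qExpansion_sub_of_mem_M (hf : f ∈ M k p) (hg : g ∈ M l p) :
    qExpansion 1 (f - g) = qExpansion 1 f - qExpansion 1 g :=
  qExpansion_sub (analyticAt_cuspFunction_of_mem_M hf) (analyticAt_cuspFunction_of_mem_M hg)

theorem qExpansion_smul_of_mem_M (hf : f ∈ M k p) (a : ℂ) :
    qExpansion 1 (a • f) = a • qExpansion 1 f :=
  qExpansion_smul (analyticAt_cuspFunction_of_mem_M hf) a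

theorem mem_M0_iff_coeff [Fact p.Prime] :
    f ∈ M0 k p ↔ f ∈ M k p ∧ (qExpansion 1 f).coeff 0 = 0 := by
  rw [mem_M0_iff]
  refine and_congr_right fun hf ↦ ?_
  rw [qExpansion_coeff_zero one_pos (analyticAt_cuspFunction_of_mem_M hf) (periodic_of_mem_M hf)]
  refine ⟨fun h ↦ h.valueAtInfty_eq_zero, fun h ↦ ?_⟩
  obtain ⟨F, rfl⟩ := hf
  have : Fact (IsCusp ∞ (Gamma0Star p)) :=
    ⟨(Gamma0Star p).isCusp_of_mem_strictPeriods one_pos one_mem_strictPeriods⟩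
  exact isZeroAtImInfty_of_valueAtInfty_eq_zero F h

end Membership

/-! ### Orders at infinity and quotients of forms. -/

section Divisibility

open Asymptotics

variable {p : ℕ} [NeZero p] {k l : ℤ} {f g : ℍ → ℂ}

/-- The cusp function is analytic at 0 with vanishing order at least n, so q^n factors out; the
cofactor at 0 is the n-th coefficient by Leibniz. -/
theorem exists_eventually_eq_qParam_pow_mul {n : ℕ} (hf : f ∈ M k p)
    (h : ∀ i < n, (qExpansion 1 f).coeff i = 0) :
    ∃ F : ℂ → ℂ, AnalyticAt ℂ F 0 ∧ (qExpansion 1 f).coeff n = F 0 ∧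
      ∀ᶠ τ : ℍ in atImInfty, f τ =
        Function.Periodic.qParam 1 τ ^ n * F (Function.Periodic.qParam 1 τ) := by
  have ha := analyticAt_cuspFunction_of_mem_M hf
  have hd : ∀ i < n, iteratedDeriv i (cuspFunction 1 f) 0 = 0 := fun i hi ↦ by
    have := h i hi
    rw [qExpansion_coeff] at this
    exact (mul_eq_zero.mp this).resolve_left
      (inv_ne_zero (Nat.cast_ne_zero.mpr i.factorial_ne_zero))
  obtain ⟨F, hF, hev⟩ := (natCast_le_analyticOrderAt ha).mp
    ((natCast_le_analyticOrderAt_iff_iteratedDeriv_eq_zero ha).mpr hd)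
  refine ⟨F, hF, ?_, ?_⟩
  · have hev' : cuspFunction 1 f =ᶠ[𝓝 0] (fun z ↦ z ^ n) * F := by
      filter_upwards [hev] with z hz
      simpa using hz
    rw [qExpansion_coeff, hev'.iteratedDeriv_eq, iteratedDeriv_mul (by fun_prop) hF.contDiffAt,
      Finset.sum_eq_single n]
    · simp [iteratedDeriv_eq_iterate]
      rw [Nat.descFactorial_self,
        inv_mul_cancel_left₀ (Nat.cast_ne_zero.mpr n.factorial_ne_zero)]
    · intro i hi hin
      have : i < n := lt_of_le_of_ne (by simpa [Nat.lt_succ_iff] using hi) hin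
      simp [iteratedDeriv_eq_iterate, Nat.sub_ne_zero_of_lt this]
    · simp
  · filter_upwards [(qParam_tendsto_atImInfty one_pos).eventually hev] with τ hτ
    rw [← eq_cuspFunction τ one_ne_zero (periodic_of_mem_M hf)]
    simpa using hτ

/-- Near infinity q^n cancels from f and g, and the remaining denominator has nonzero limit, so the
quotient stays bounded. -/
theorem div_mem_M [Fact p.Prime] {n : ℕ} (hf : f ∈ M k p) (hg : g ∈ M l p)
    (hg0 : ∀ z, g z ≠ 0) (hfn : ∀ i < n, (qExpansion 1 f).coeff i = 0)
    (hgn : ∀ i < n, (qExpansion 1 g).coeff i = 0) (hgn' : (qExpansion 1 g).coeff n ≠ 0) :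
    f / g ∈ M (k - l) p := by
  refine mem_M_iff.mpr ⟨?_, fun γ hγ ↦ ?_, ?_⟩
  · rw [UpperHalfPlane.mdifferentiable_iff]
    exact (UpperHalfPlane.mdifferentiable_iff.mp (mdifferentiable_of_mem_M hf)).div
      (UpperHalfPlane.mdifferentiable_iff.mp (mdifferentiable_of_mem_M hg)) fun z _ ↦ hg0 _
  · rw [slash_div_of_mem hγ, (mem_M_iff.mp hf).2.1 γ hγ, (mem_M_iff.mp hg).2.1 γ hγ]
  · obtain ⟨F, hF, -, hf'⟩ := exists_eventually_eq_qParam_pow_mul hf hfn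
    obtain ⟨G, hG, hG0, hg'⟩ := exists_eventually_eq_qParam_pow_mul hg hgn
    have hq := qParam_tendsto_atImInfty (h := 1) one_pos
    rw [hG0] at hgn'
    have ht : Tendsto (fun τ : ℍ ↦ F (Function.Periodic.qParam 1 τ) /
        G (Function.Periodic.qParam 1 τ)) atImInfty (𝓝 (F 0 / G 0)) :=
      (hF.continuousAt.tendsto.comp hq).div (hG.continuousAt.tendsto.comp hq) hgn'
    refine IsBigO.congr' (ht.isBigO_one ℝ) ?_ EventuallyEq.rfl
    filter_upwards [hf', hg'] with τ h1 h2
    rw [Pi.div_apply, h1, h2, mul_div_mul_left]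
    exact pow_ne_zero _ (Function.Periodic.qParam_ne_zero _)

end Divisibility

/-! ### From level one to `Gamma0Star p` through z ↦ pz. -/

section Scale

variable {p : ℕ} [NeZero p] {k : ℤ} {f : ℍ → ℂ}

@[simp] theorem coe_scale (z : ℍ) : (scale p z : ℂ) = p * z := rfl

/-- δ is the conjugate of γ by diag(p, 1), integral because p divides the lower left entry of γ. -/
theorem exists_scale_smul_eq {γ : SL(2, ℤ)} (hγ : γ ∈ Gamma0 p) :
    ∃ δ : SL(2, ℤ), ∀ z : ℍ, scale p (γ • z) = δ • scale p z ∧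
      denom γ z = denom δ (scale p z) := by
  have hp : (p : ℂ) ≠ 0 := NeZero.ne _
  rw [Gamma0_mem, ZMod.intCast_zmod_eq_zero_iff_dvd] at hγ
  obtain ⟨c, hc⟩ := hγ
  have hdet : γ 0 0 * γ 1 1 - γ 0 1 * γ 1 0 = 1 := by
    have := γ.det_coe
    rwa [Matrix.det_fin_two] at this
  have hdet' : (!![γ 0 0, p * γ 0 1; c, γ 1 1] : Matrix (Fin 2) (Fin 2) ℤ).det = 1 := by
    rw [Matrix.det_fin_two_of]
    rw [hc] at hdet
    linarith
  obtain ⟨δ, hδ⟩ : ∃ δ : SL(2, ℤ), (δ : Matrix (Fin 2) (Fin 2) ℤ) =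
      !![γ 0 0, p * γ 0 1; c, γ 1 1] := ⟨⟨_, hdet'⟩, rfl⟩
  refine ⟨δ, fun z ↦ ⟨?_, ?_⟩⟩
  · ext
    rw [coe_scale, coe_specialLinearGroup_apply, coe_specialLinearGroup_apply, hδ]
    simp [hc]
    ring
  · rw [ModularGroup.denom_apply, ModularGroup.denom_apply, hδ]
    simp [hc]
    ring

theorem denom_W (z : ℍ) : denom (toGL (W p)) z = (√(p : ℝ) : ℂ) * z := by
  simp [denom, coe_W]

theorem coe_W_smul (z : ℍ) : ((toGL (W p) • z : ℍ) : ℂ) = -1 / (p * z) := by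
  have h : (√(p : ℝ) : ℂ) ≠ 0 := by
    exact_mod_cast Real.sqrt_ne_zero'.mpr (Nat.cast_pos.mpr (Nat.pos_of_ne_zero (NeZero.ne p)))
  have hs : (√(p : ℝ) : ℂ) * √(p : ℝ) = p := by
    exact_mod_cast Real.mul_self_sqrt (Nat.cast_nonneg p)
  rw [coe_smul_of_det_pos (by simp), denom_W, ← hs]
  simp [num, coe_W]
  field_simp

theorem W_smul (z : ℍ) : toGL (W p) • z = ModularGroup.S • scale p z := by
  ext
  rw [coe_W_smul, modular_S_smul]
  simp [neg_div]

theorem scale_W_smul (z : ℍ) : scale p (toGL (W p) • z) = ModularGroup.S • z := by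
  have hp : (p : ℂ) ≠ 0 := NeZero.ne _
  ext
  rw [coe_scale, coe_W_smul, modular_S_smul]
  have := z.ne_zero
  simp only
  field_simp

theorem slash_Gamma0_scale (hf : ∀ γ : SL(2, ℤ), f ∣[k] γ = f) {γ : SL(2, ℤ)}
    (hγ : γ ∈ Gamma0 p) : (f ∘ scale p) ∣[k] γ = f ∘ scale p := by
  obtain ⟨δ, hδ⟩ := exists_scale_smul_eq hγ
  ext z
  rw [SL_slash_apply, (hδ z).2, Function.comp_apply, (hδ z).1, ← SL_slash_apply, hf,
    Function.comp_apply]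

theorem apply_S_smul (hf : ∀ γ : SL(2, ℤ), f ∣[k] γ = f) (z : ℍ) :
    f (ModularGroup.S • z) = (z : ℂ) ^ k * f z := by
  have := congrFun (hf ModularGroup.S) z
  rw [SL_slash_apply, ModularGroup.denom_S] at this
  rw [← this, zpow_neg, mul_comm, inv_mul_cancel_right₀ (zpow_ne_zero _ z.ne_zero)]

theorem sqrt_zpow_mul_sqrt_zpow (p : ℕ) (k : ℤ) :
    (√(p : ℝ) : ℂ) ^ k * (√(p : ℝ) : ℂ) ^ k = (p : ℂ) ^ k := by
  rw [← mul_zpow]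
  congr 1
  exact_mod_cast Real.mul_self_sqrt (Nat.cast_nonneg p)

/-- Wz = S(pz). With `slash_W_scale`, W exchanges f(z) and f(pz) up to inverse constants, so that
suitable sums, and the product, are W-invariant. -/
theorem slash_W (hf : ∀ γ : SL(2, ℤ), f ∣[k] γ = f) :
    f ∣[k] toGL (W p) = (√(p : ℝ) : ℂ) ^ k • (f ∘ scale p) := by
  have h : (√(p : ℝ) : ℂ) ≠ 0 := by
    exact_mod_cast Real.sqrt_ne_zero'.mpr (Nat.cast_pos.mpr (Nat.pos_of_ne_zero (NeZero.ne p)))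
  ext z
  have hz := z.ne_zero
  rw [slash_apply_of_mem toGL_W_mem, denom_W, W_smul, apply_S_smul hf, coe_scale, zpow_neg,
    mul_zpow, mul_zpow, ← sqrt_zpow_mul_sqrt_zpow]
  simp only [Pi.smul_apply, Function.comp_apply, smul_eq_mul]
  field_simp

theorem slash_W_scale (hf : ∀ γ : SL(2, ℤ), f ∣[k] γ = f) :
    (f ∘ scale p) ∣[k] toGL (W p) = ((√(p : ℝ) : ℂ) ^ k)⁻¹ • f := by
  have h : (√(p : ℝ) : ℂ) ≠ 0 := by
    exact_mod_cast Real.sqrt_ne_zero'.mpr (Nat.cast_pos.mpr (Nat.pos_of_ne_zero (NeZero.ne p)))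
  ext z
  have hz := z.ne_zero
  rw [slash_apply_of_mem toGL_W_mem, denom_W, Function.comp_apply, scale_W_smul, apply_S_smul hf,
    zpow_neg, mul_zpow]
  simp only [Pi.smul_apply, smul_eq_mul]
  field_simp

theorem tendsto_scale : Tendsto (scale p) atImInfty atImInfty := by
  rw [atImInfty, tendsto_comap_iff]
  have : (im ∘ scale p) = fun z : ℍ ↦ (p : ℝ) * z.im := by
    ext z
    simp [← coe_im]
  rw [this]
  exact tendsto_comap.const_mul_atTop (Nat.cast_pos.mpr (Nat.pos_of_ne_zero (NeZero.ne p)))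

theorem mdifferentiable_comp_scale (hf : MDiff f) : MDiff (f ∘ scale p) := by
  have hp : (0 : ℝ) < p := Nat.cast_pos.mpr (Nat.pos_of_ne_zero (NeZero.ne p))
  rw [UpperHalfPlane.mdifferentiable_iff] at hf ⊢
  have hm : Set.MapsTo (fun z : ℂ ↦ (p : ℂ) * z) {z | 0 < z.im} {z | 0 < z.im} :=
    fun z hz ↦ by simpa using mul_pos hp hz
  refine (hf.comp (t := {z : ℂ | 0 < z.im}) (by fun_prop) hm).congr fun z hz ↦ ?_
  have hpz : 0 < ((p : ℂ) * z).im := hm hz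
  simp only [Function.comp_apply, ofComplex_apply_of_im_pos hz, ofComplex_apply_of_im_pos hpz]
  rfl

theorem periodic_comp_scale (hf : Function.Periodic (f ∘ ofComplex) (1 : ℝ)) :
    Function.Periodic ((f ∘ scale p) ∘ ofComplex) (1 : ℝ) := by
  have hp : (0 : ℝ) < p := Nat.cast_pos.mpr (Nat.pos_of_ne_zero (NeZero.ne p))
  have key : ∀ z : ℂ, 0 < z.im → f (scale p (ofComplex z)) = (f ∘ ofComplex) (p * z) := by
    intro z hz
    have hpz : 0 < ((p : ℂ) * z).im := by simpa using mul_pos hp hz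
    simp only [Function.comp_apply, ofComplex_apply_of_im_pos hz, ofComplex_apply_of_im_pos hpz]
    rfl
  intro z
  by_cases hz : 0 < z.im
  · have hz' : 0 < (z + (1 : ℝ)).im := by simpa using hz
    have := hf.nat_mul p (p * z)
    simp only [Function.comp_apply] at this ⊢
    rw [key _ hz, key _ hz', Function.comp_apply, Function.comp_apply, ← this]
    congr 2
    push_cast
    ring
  · have hz' : (z + (1 : ℝ)).im ≤ 0 := by simpa using hz
    simp only [Function.comp_apply, ofComplex_apply_of_im_nonpos (not_lt.mp hz),
      ofComplex_apply_of_im_nonpos hz']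

theorem qExpansion_comp_scale_coeff (hper : Function.Periodic (f ∘ ofComplex) (1 : ℝ))
    (hd : MDiff f) (hb : IsBoundedAtImInfty f) (m : ℕ) :
    (qExpansion 1 (f ∘ scale p)).coeff m =
      if p ∣ m then (qExpansion 1 f).coeff (m / p) else 0 := by
  have hp := NeZero.ne p
  have hb' : IsBoundedAtImInfty (f ∘ scale p) := hb.comp_tendsto tendsto_scale
  let _ : FunLike (ℍ → ℂ) ℍ ℂ := ⟨id, fun _ _ h ↦ h⟩
  refine (qExpansion_coeff_unique (f ∘ scale p) one_pos (analyticAt_cuspFunction_zero one_pos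
    (periodic_comp_scale hper) (mdifferentiable_comp_scale hd) hb')
    (c := fun m ↦ if p ∣ m then (qExpansion 1 f).coeff (m / p) else 0) (fun τ ↦ ?_) m).symm
  -- Replacing z by pz turns q into q^p, so only exponents divisible by p contribute.
  have hinj : Function.Injective fun m : ℕ ↦ p * m := fun a b h ↦ Nat.eq_of_mul_eq_mul_left
    (Nat.pos_of_ne_zero hp) h
  refine (hinj.hasSum_iff fun m hm ↦ ?_).mp ?_
  · rw [if_neg, zero_smul]
    rintro ⟨c, rfl⟩
    exact hm ⟨c, rfl⟩
  · change HasSum _ (f (scale p τ))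
    convert! hasSum_qExpansion one_pos hper hd hb (scale p τ) using 2 with m
    simp only [Function.comp_apply, dvd_mul_right, if_true,
      Nat.mul_div_cancel_left _ (Nat.pos_of_ne_zero hp), pow_mul]
    congr 2
    simp only [Function.Periodic.qParam, ← Complex.exp_nat_mul, coe_scale]
    congr 1
    ring

/-- Level-one forms `f` of even weight `2m` give `p^m f(pz) + f(z)` on `Γ₀*(p)`. -/
theorem smul_comp_scale_add_mem_M [Fact p.Prime] {m : ℤ} (F : ModularForm 𝒮ℒ k) (hk : k = 2 * m) :
    ((p : ℂ) ^ m • (F ∘ scale p) + F) ∈ M k p := by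
  subst hk
  have hF : ∀ γ : SL(2, ℤ), (F : ℍ → ℂ) ∣[2 * m] γ = F := fun γ ↦ F.slash_action_eq' _ ⟨γ, rfl⟩
  have hs : (√(p : ℝ) : ℂ) ^ (2 * m) = (p : ℂ) ^ m := by
    rw [two_mul, zpow_add₀, sqrt_zpow_mul_sqrt_zpow]
    exact_mod_cast Real.sqrt_ne_zero'.mpr (Nat.cast_pos.mpr (Nat.pos_of_ne_zero (NeZero.ne p)))
  have hp : (p : ℂ) ^ m ≠ 0 := zpow_ne_zero _ (NeZero.ne _)
  have hb : IsBoundedAtImInfty F := isBoundedAt_infty_iff.mp <| F.bdd_at_cusps' <|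
    (𝒮ℒ).isCusp_of_mem_strictPeriods one_pos one_mem_strictPeriods_SL
  refine mem_M_iff.mpr ⟨?_, fun g hg ↦ slash_eq_of_forall_Gamma0 (fun γ hγ ↦ ?_) ?_ hg, ?_⟩
  · exact ((mdifferentiable_comp_scale F.holo').const_smul _).add F.holo'
  · rw [SlashAction.add_slash, SL_smul_slash, slash_Gamma0_scale hF hγ, hF]
  · have hσ : ∀ c : ℂ, σ (toGL (W p)) c = c := fun c ↦ by simp [σ]
    rw [SlashAction.add_slash, smul_slash, slash_W_scale hF, slash_W hF, hs, hσ, smul_smul,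
      mul_inv_cancel₀ hp, one_smul, add_comm]
  · exact ((hb.comp_tendsto (tendsto_scale (p := p))).const_smul_left _).add hb

theorem comp_scale_mul_mem_M [Fact p.Prime] (F : ModularForm 𝒮ℒ k) :
    ((F ∘ scale p) * F) ∈ M (k + k) p := by
  have hF : ∀ γ : SL(2, ℤ), (F : ℍ → ℂ) ∣[k] γ = F := fun γ ↦ F.slash_action_eq' _ ⟨γ, rfl⟩
  have hp : (√(p : ℝ) : ℂ) ^ k ≠ 0 := zpow_ne_zero _ <| by
    exact_mod_cast Real.sqrt_ne_zero'.mpr (Nat.cast_pos.mpr (Nat.pos_of_ne_zero (NeZero.ne p)))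
  have hb : IsBoundedAtImInfty F := isBoundedAt_infty_iff.mp <| F.bdd_at_cusps' <|
    (𝒮ℒ).isCusp_of_mem_strictPeriods one_pos one_mem_strictPeriods_SL
  refine mem_M_iff.mpr ⟨?_, fun g hg ↦ slash_eq_of_forall_Gamma0 (fun γ hγ ↦ ?_) ?_ hg, ?_⟩
  · exact (mdifferentiable_comp_scale F.holo').mul F.holo'
  · rw [mul_slash_SL2, slash_Gamma0_scale hF hγ, hF]
  · rw [slash_mul_of_mem toGL_W_mem, slash_W_scale hF, slash_W hF, smul_mul_smul_comm,
      inv_mul_cancel₀ hp, one_smul, mul_comm]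
  · have hb' : IsBoundedAtImInfty (F ∘ scale p) := hb.comp_tendsto tendsto_scale
    exact BoundedAtFilter.mul hb' hb

end Scale

/-! ### The series `Estar` and their first coefficients. -/

section Eisenstein

variable {p : ℕ} [NeZero p]

theorem Estar_zero : Estar 0 p = 1 := by
  ext z
  simp [Estar, Eis, one_add_one_eq_two]

theorem Estar_eq {k : ℕ} (hk : 3 ≤ k) : Estar k p = (1 / ((p : ℂ) ^ ((k : ℤ) / 2) + 1)) •
    ((p : ℂ) ^ ((k : ℤ) / 2) • (E hk ∘ scale p) + E hk) := by
  have h0 : (k : ℤ) ≠ 0 := by omega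
  have hE : Eis k = E hk := by
    ext z
    simp only [Eis, if_neg h0]
    rfl
  ext z
  simp only [Estar, hE]
  rfl

theorem Estar_mem_M_of_le [Fact p.Prime] {k : ℕ} (hk : 3 ≤ k) (hk2 : Even k) :
    Estar k p ∈ M k p := by
  have h : (k : ℤ) = 2 * ((k : ℤ) / 2) := by
    have := hk2.two_dvd
    omega
  rw [Estar_eq hk]
  exact Submodule.smul_mem _ _ (smul_comp_scale_add_mem_M (E hk) h)

theorem Estar_qExpansion_coeff {k : ℕ} (hk : 3 ≤ k) (n : ℕ) :
    (qExpansion 1 (Estar k p)).coeff n = 1 / ((p : ℂ) ^ (k / 2) + 1) *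
      ((p : ℂ) ^ (k / 2) * (if p ∣ n then (qExpansion 1 (E hk)).coeff (n / p) else 0) +
        (qExpansion 1 (E hk)).coeff n) := by
  have hb : IsBoundedAtImInfty (E hk) := isBoundedAt_infty_iff.mp <| (E hk).bdd_at_cusps' <|
    (𝒮ℒ).isCusp_of_mem_strictPeriods one_pos one_mem_strictPeriods_SL
  have hper := SlashInvariantFormClass.periodic_comp_ofComplex (E hk) one_mem_strictPeriods_SL
  have ha := ModularFormClass.analyticAt_cuspFunction_zero (E hk) one_pos one_mem_strictPeriods_SL
  have hd : MDiff (E hk) := (E hk).holo'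
  have ha' : AnalyticAt ℂ (cuspFunction 1 (E hk ∘ scale p)) 0 :=
    analyticAt_cuspFunction_zero one_pos (periodic_comp_scale hper)
      (mdifferentiable_comp_scale hd) (hb.comp_tendsto tendsto_scale)
  have hs : ∀ (c : ℂ) {f : ℍ → ℂ}, AnalyticAt ℂ (cuspFunction 1 f) 0 →
      AnalyticAt ℂ (cuspFunction 1 (c • f)) 0 := fun c f hf ↦ by
    rw [cuspFunction_smul hf.continuousAt]
    exact hf.const_smul
  have hadd : AnalyticAt ℂ (cuspFunction 1
      ((p : ℂ) ^ ((k : ℤ) / 2) • (E hk ∘ scale p) + E hk)) 0 := by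
    rw [cuspFunction_add (hs _ ha').continuousAt ha.continuousAt]
    exact (hs _ ha').add ha
  rw [Estar_eq hk, qExpansion_smul hadd, qExpansion_add (hs _ ha') ha, qExpansion_smul ha',
    PowerSeries.coeff_smul, map_add, PowerSeries.coeff_smul, qExpansion_comp_scale_coeff hper hd hb,
    smul_eq_mul, smul_eq_mul, show ((k : ℤ) / 2) = ((k / 2 : ℕ) : ℤ) by simp, zpow_natCast]

theorem Estar_mem_M [Fact p.Prime] {k : ℤ} (hk2 : Even k) (hk : k = 0 ∨ 4 ≤ k) :
    Estar k p ∈ M k p := by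
  rcases hk with rfl | hk
  · rw [Estar_zero]
    exact one_mem_M
  · lift k to ℕ using by omega
    exact Estar_mem_M_of_le (by omega) (by exact_mod_cast hk2)

theorem Estar_qExpansion_coeff_zero {k : ℤ} (hk2 : Even k) (hk : k = 0 ∨ 4 ≤ k) :
    (qExpansion 1 (Estar k p)).coeff 0 = 1 := by
  rcases hk with rfl | hk
  · rw [Estar_zero, qExpansion_one]
    simp
  · lift k to ℕ using by omega
    have hk2 : Even k := by exact_mod_cast hk2
    have hk3 : 3 ≤ k := by omega
    have h : ((p : ℂ) ^ (k / 2) + 1) ≠ 0 := by exact_mod_cast Nat.succ_ne_zero (p ^ (k / 2))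
    rw [Estar_qExpansion_coeff hk3, Nat.zero_div,
      EisensteinSeries.E_qExpansion_coeff_zero hk3 hk2, if_pos (dvd_zero _), mul_one,
      one_div_mul_cancel h]

theorem Estar_ne_zero {k : ℤ} (hk2 : Even k) (hk : k = 0 ∨ 4 ≤ k) : Estar k p ≠ 0 := by
  intro h
  have := Estar_qExpansion_coeff_zero (p := p) hk2 hk
  rw [h, qExpansion_zero] at this
  simp at this

theorem sigma_apply_two (k : ℕ) : ArithmeticFunction.sigma k 2 = 1 + 2 ^ k := by
  simp [ArithmeticFunction.sigma_apply, show Nat.divisors 2 = {1, 2} by decide]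

theorem Estar_four_coeff_one : (qExpansion 1 (Estar 4 3)).coeff 1 = 24 := by
  have := Estar_qExpansion_coeff (p := 3) (k := 4) (by norm_num) 1
  rw [EisensteinSeries.E_qExpansion_coeff _ ⟨2, rfl⟩,
    EisensteinSeries.E_qExpansion_coeff _ ⟨2, rfl⟩] at this
  norm_num [show bernoulli 4 = -1 / 30 by decide +kernel] at this
  exact this

theorem Estar_four_coeff_two : (qExpansion 1 (Estar 4 3)).coeff 2 = 216 := by
  have := Estar_qExpansion_coeff (p := 3) (k := 4) (by norm_num) 2
  rw [EisensteinSeries.E_qExpansion_coeff _ ⟨2, rfl⟩,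
    EisensteinSeries.E_qExpansion_coeff _ ⟨2, rfl⟩] at this
  norm_num [show bernoulli 4 = -1 / 30 by decide +kernel, sigma_apply_two] at this
  exact this

theorem Estar_six_coeff_one : (qExpansion 1 (Estar 6 3)).coeff 1 = -18 := by
  have := Estar_qExpansion_coeff (p := 3) (k := 6) (by norm_num) 1
  rw [EisensteinSeries.E_qExpansion_coeff _ ⟨3, rfl⟩,
    EisensteinSeries.E_qExpansion_coeff _ ⟨3, rfl⟩] at this
  norm_num [show bernoulli 6 = 1 / 42 by decide +kernel] at this
  exact this

theorem Estar_eight_coeff_one : (qExpansion 1 (Estar 8 3)).coeff 1 = 240 / 41 := by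
  have := Estar_qExpansion_coeff (p := 3) (k := 8) (by norm_num) 1
  rw [EisensteinSeries.E_qExpansion_coeff _ ⟨4, rfl⟩,
    EisensteinSeries.E_qExpansion_coeff _ ⟨4, rfl⟩] at this
  norm_num [show bernoulli 8 = -1 / 30 by decide +kernel] at this
  exact this

theorem Estar_eight_coeff_two : (qExpansion 1 (Estar 8 3)).coeff 2 = 30960 / 41 := by
  have := Estar_qExpansion_coeff (p := 3) (k := 8) (by norm_num) 2
  rw [EisensteinSeries.E_qExpansion_coeff _ ⟨4, rfl⟩,
    EisensteinSeries.E_qExpansion_coeff _ ⟨4, rfl⟩] at this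
  norm_num [show bernoulli 8 = -1 / 30 by decide +kernel, sigma_apply_two] at this
  exact this

theorem Estar_ten_coeff_one : (qExpansion 1 (Estar 10 3)).coeff 1 = -(66 / 61) := by
  have := Estar_qExpansion_coeff (p := 3) (k := 10) (by norm_num) 1
  rw [EisensteinSeries.E_qExpansion_coeff _ ⟨5, rfl⟩,
    EisensteinSeries.E_qExpansion_coeff _ ⟨5, rfl⟩] at this
  norm_num [show bernoulli 10 = 5 / 66 by decide +kernel] at this
  exact this

end Eisenstein

/-! ### The zero-free form `discMul` of weight 24. -/

section Discriminant

theorem E₄_qExpansion_coeff_two : (qExpansion 1 E₄).coeff 2 = 2160 := by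
  norm_num [EisensteinSeries.E_qExpansion_coeff _ (show Even 4 from ⟨2, rfl⟩), sigma_apply_two,
    show bernoulli 4 = -1 / 30 by decide +kernel]

theorem E₆_qExpansion_coeff_two : (qExpansion 1 E₆).coeff 2 = -16632 := by
  norm_num [EisensteinSeries.E_qExpansion_coeff _ (show Even 6 from ⟨3, rfl⟩), sigma_apply_two,
    show bernoulli 6 = 1 / 42 by decide +kernel]

theorem discriminant_qExpansion_coeff_two : (qExpansion 1 discriminant).coeff 2 = -24 := by
  have h : discriminant = (1 / 1728 : ℂ) • ((E₄.pow 3 : ℍ → ℂ) - (E₆.pow 2 : ℍ → ℂ)) := by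
    ext z
    rw [discriminant_eq_E₄_cube_sub_E₆_sq z, ModularForm.coe_pow, ModularForm.coe_pow]
    simp [div_eq_inv_mul]
  have h4 := ModularFormClass.analyticAt_cuspFunction_zero (E₄.pow 3) one_pos
    one_mem_strictPeriods_SL
  have h6 := ModularFormClass.analyticAt_cuspFunction_zero (E₆.pow 2) one_pos
    one_mem_strictPeriods_SL
  have hsub : AnalyticAt ℂ (cuspFunction 1 ((E₄.pow 3 : ℍ → ℂ) - (E₆.pow 2 : ℍ → ℂ))) 0 := by
    rw [cuspFunction_sub h4.continuousAt h6.continuousAt]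
    exact h4.sub h6
  rw [h, qExpansion_smul hsub, qExpansion_sub h4 h6,
    ModularForm.qExpansion_pow one_pos one_mem_strictPeriods_SL,
    ModularForm.qExpansion_pow one_pos one_mem_strictPeriods_SL]
  norm_num [pow_succ, PowerSeries.coeff_mul, Finset.Nat.antidiagonal_succ, E₄_qExpansion_coeff_one,
    E₆_qExpansion_coeff_one, E₄_qExpansion_coeff_two, E₆_qExpansion_coeff_two,
    -PowerSeries.coeff_zero_eq_constantCoeff,
    EisensteinSeries.E_qExpansion_coeff_zero _ (show Even 4 from ⟨2, rfl⟩),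
    EisensteinSeries.E_qExpansion_coeff_zero _ (show Even 6 from ⟨3, rfl⟩)]

/-- `Δ(3z) Δ(z)`, a form of weight 24 for `Γ₀*(3)` without zeros on the upper half-plane. -/
def discMul : ℍ → ℂ := (discriminant ∘ scale 3) * discriminant

theorem discMul_mem_M : discMul ∈ M 24 3 :=
  have : Fact (Nat.Prime 3) := ⟨Nat.prime_three⟩
  comp_scale_mul_mem_M (ModularFormClass.modularForm CuspForm.discriminant : ModularForm 𝒮ℒ 12)

theorem discMul_ne_zero (z : ℍ) : discMul z ≠ 0 :=
  mul_ne_zero (discriminant_ne_zero _) (discriminant_ne_zero _)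

/-- Δ(3z) = q³ + O(q⁶) and Δ(z) = q - 24q² + ⋯. The second coefficient of B is needed in
`Delta8_pow_four`. -/
theorem exists_qExpansion_discMul : ∃ B : PowerSeries ℂ,
    qExpansion 1 discMul = PowerSeries.X ^ 4 * B ∧ B.coeff 0 = 1 ∧ B.coeff 1 = -24 := by
  have hΔ : ⇑CuspForm.discriminant = discriminant := rfl
  have hb : IsBoundedAtImInfty discriminant := discriminant_isZeroAtImInfty.isBoundedAtImInfty
  have hper := SlashInvariantFormClass.periodic_comp_ofComplex CuspForm.discriminant
    one_mem_strictPeriods_SL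
  have ha := ModularFormClass.analyticAt_cuspFunction_zero CuspForm.discriminant one_pos
    one_mem_strictPeriods_SL
  have hd : MDiff discriminant := CuspForm.discriminant.holo'
  rw [hΔ] at hper ha
  have ha' : AnalyticAt ℂ (cuspFunction 1 (discriminant ∘ scale 3)) 0 :=
    analyticAt_cuspFunction_zero one_pos (periodic_comp_scale hper)
      (mdifferentiable_comp_scale hd) (hb.comp_tendsto tendsto_scale)
  have h0 : (qExpansion 1 discriminant).coeff 0 = 0 :=
    CuspFormClass.qExpansion_coeff_zero CuspForm.discriminant one_pos one_mem_strictPeriods_SL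
  have hq : ∀ n, (qExpansion 1 discMul).coeff n = ∑ x ∈ Finset.HasAntidiagonal.antidiagonal n,
      (if 3 ∣ x.1 then (qExpansion 1 discriminant).coeff (x.1 / 3) else 0) *
        (qExpansion 1 discriminant).coeff x.2 := fun n ↦ by
    rw [discMul, qExpansion_mul ha' ha, PowerSeries.coeff_mul]
    simp only [qExpansion_comp_scale_coeff hper hd hb]
  obtain ⟨B, hB⟩ : PowerSeries.X ^ 4 ∣ qExpansion 1 discMul := by
    rw [PowerSeries.X_pow_dvd_iff]
    intro m hm
    interval_cases m <;> rw [hq] <;>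
      simp [Finset.Nat.antidiagonal_succ, h0, -PowerSeries.coeff_zero_eq_constantCoeff]
  have hB' : ∀ n, B.coeff n = (qExpansion 1 discMul).coeff (n + 4) := fun n ↦ by
    rw [hB, PowerSeries.coeff_X_pow_mul]
  refine ⟨B, hB, ?_, ?_⟩ <;> rw [hB', hq] <;>
    simp [Finset.Nat.antidiagonal_succ, h0, discriminant_qExpansion_coeff_one,
      discriminant_qExpansion_coeff_two, -PowerSeries.coeff_zero_eq_constantCoeff]

end Discriminant

/-! ### Vanishing in small weight at level three. -/

section LevelThree

instance : Fact (Nat.Prime 3) := ⟨Nat.prime_three⟩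

variable {k l : ℤ} {f g : ℍ → ℂ}

theorem qExpansion_mul_coeff_zero_of_mem_M {p : ℕ} [NeZero p] (hf : f ∈ M k p) (hg : g ∈ M l p) :
    (qExpansion 1 (f * g)).coeff 0 = (qExpansion 1 f).coeff 0 * (qExpansion 1 g).coeff 0 := by
  rw [qExpansion_mul_of_mem_M hf hg, PowerSeries.coeff_mul]
  simp [-PowerSeries.coeff_zero_eq_constantCoeff]

theorem qExpansion_mul_coeff_one_of_mem_M {p : ℕ} [NeZero p] (hf : f ∈ M k p) (hg : g ∈ M l p) :
    (qExpansion 1 (f * g)).coeff 1 = (qExpansion 1 f).coeff 0 * (qExpansion 1 g).coeff 1 +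
      (qExpansion 1 f).coeff 1 * (qExpansion 1 g).coeff 0 := by
  rw [qExpansion_mul_of_mem_M hf hg, PowerSeries.coeff_mul]
  simp [Finset.Nat.antidiagonal_succ, -PowerSeries.coeff_zero_eq_constantCoeff]

theorem qExpansion_mul_coeff_two_of_mem_M {p : ℕ} [NeZero p] (hf : f ∈ M k p) (hg : g ∈ M l p) :
    (qExpansion 1 (f * g)).coeff 2 = (qExpansion 1 f).coeff 0 * (qExpansion 1 g).coeff 2 +
      (qExpansion 1 f).coeff 1 * (qExpansion 1 g).coeff 1 +
      (qExpansion 1 f).coeff 2 * (qExpansion 1 g).coeff 0 := by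
  rw [qExpansion_mul_of_mem_M hf hg, PowerSeries.coeff_mul]
  simp [Finset.Nat.antidiagonal_succ, -PowerSeries.coeff_zero_eq_constantCoeff, add_assoc]

theorem div_discMul_mem_M (hf : f ∈ M k 3) (h : PowerSeries.X ^ 4 ∣ qExpansion 1 f) :
    f / discMul ∈ M (k - 24) 3 := by
  obtain ⟨B, hB, hB0, -⟩ := exists_qExpansion_discMul
  refine div_mem_M (n := 4) hf discMul_mem_M discMul_ne_zero (PowerSeries.X_pow_dvd_iff.mp h)
    (PowerSeries.X_pow_dvd_iff.mp ⟨B, hB⟩) ?_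
  rw [hB, PowerSeries.coeff_X_pow_mul' _ 4 4, if_pos le_rfl, Nat.sub_self, hB0]
  exact one_ne_zero

theorem eq_zero_of_div_discMul_eq_zero {n : ℕ} (h : f ^ n / discMul = 0) : f = 0 := by
  ext z
  have := congrFun h z
  simp only [Pi.div_apply, Pi.pow_apply, Pi.zero_apply, div_eq_zero_iff, discMul_ne_zero,
    or_false] at this
  exact eq_zero_of_pow_eq_zero this

theorem X_pow_dvd_qExpansion_pow {m : ℕ} (hf : f ∈ M k 3)
    (h : ∀ i < m, (qExpansion 1 f).coeff i = 0) (n : ℕ) :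
    PowerSeries.X ^ (m * n) ∣ qExpansion 1 (f ^ n) := by
  rw [qExpansion_pow_of_mem_M hf, pow_mul]
  exact pow_dvd_pow_of_dvd (PowerSeries.X_pow_dvd_iff.mpr h) n

/-- f² has order at least 4, and f² / `discMul` has the negative weight 2k - 24. -/
theorem eq_zero_of_coeff_eq_zero_of_lt_twelve (hk : k < 12) (hf : f ∈ M k 3)
    (h0 : (qExpansion 1 f).coeff 0 = 0) (h1 : (qExpansion 1 f).coeff 1 = 0) : f = 0 := by
  have h : ∀ i < 2, (qExpansion 1 f).coeff i = 0 := fun i hi ↦ by interval_cases i <;> assumption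
  exact eq_zero_of_div_discMul_eq_zero (n := 2) <| eq_zero_of_neg_weight (p := 3) (by omega)
    (div_discMul_mem_M (pow_mem_M hf 2 rfl) (X_pow_dvd_qExpansion_pow hf h 2))

theorem pow_four_div_discMul_mem_M (hf : f ∈ M k 3) (h0 : (qExpansion 1 f).coeff 0 = 0) :
    f ^ 4 / discMul ∈ M (4 * k - 24) 3 := by
  have h : ∀ i < 1, (qExpansion 1 f).coeff i = 0 := fun i hi ↦ by interval_cases i; assumption
  exact div_discMul_mem_M (pow_mem_M hf 4 rfl) (X_pow_dvd_qExpansion_pow hf h 4)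

/-- W₃ fixes i/√3 with automorphy factor i. Since i⁻⁶ = -1, invariance reads f = -f at that point.
-/
theorem apply_eq_zero_of_weight_six (hf : f ∈ M 6 3) : ∃ z, f z = 0 := by
  have hs : (0 : ℝ) < √3 := by positivity
  let z : ℍ := ⟨Complex.I / √(3 : ℝ), by
    rw [Complex.div_ofReal_im, Complex.I_im]; positivity⟩
  have hs' : (√(3 : ℝ) : ℂ) ≠ 0 := by exact_mod_cast hs.ne'
  have hss : (√(3 : ℝ) : ℂ) * √(3 : ℝ) = 3 := by
    exact_mod_cast Real.mul_self_sqrt (by norm_num)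
  have hz : (z : ℂ) = Complex.I / √(3 : ℝ) := rfl
  have hW : toGL (W 3) • z = z := by
    ext
    rw [coe_W_smul, hz, Nat.cast_ofNat, ← hss]
    field_simp
    simp
  refine ⟨z, ?_⟩
  have h := congrFun ((mem_M_iff.mp hf).2.1 _ toGL_W_mem) z
  rw [slash_apply_of_mem toGL_W_mem, hW, denom_W, hz, Nat.cast_ofNat, mul_div_cancel₀ _ hs'] at h
  have hI : (Complex.I : ℂ) ^ (-6 : ℤ) = -1 := by
    rw [zpow_neg, show (6 : ℤ) = ((6 : ℕ) : ℤ) by rfl, zpow_natCast,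
      show Complex.I ^ 6 = (Complex.I ^ 2) ^ 3 by ring, Complex.I_sq]
    norm_num
  rw [hI] at h
  linear_combination (-1 / 2 : ℂ) * h

/-- f⁴ / `discMul` has weight 4k - 24 ≤ 0. In the borderline weight 6 it is a constant, and the zero
at i/√3 makes that constant 0. -/
theorem eq_zero_of_coeff_zero_of_le_six (hk : k ≤ 6) (hf : f ∈ M k 3)
    (h0 : (qExpansion 1 f).coeff 0 = 0) : f = 0 := by
  have h := pow_four_div_discMul_mem_M hf h0
  rcases hk.lt_or_eq with hk | rfl
  · exact eq_zero_of_div_discMul_eq_zero (eq_zero_of_neg_weight (by omega) h)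
  · obtain ⟨c, hc⟩ := eq_const_of_weight_zero h
    obtain ⟨z, hz⟩ := apply_eq_zero_of_weight_six hf
    have hcz := congrFun hc z
    simp only [Pi.div_apply, Pi.pow_apply, hz, Pi.smul_apply, Pi.one_apply, smul_eq_mul, mul_one,
      ne_eq, OfNat.ofNat_ne_zero, not_false_eq_true, zero_pow, zero_div] at hcz
    rw [← hcz, zero_smul] at hc
    exact eq_zero_of_div_discMul_eq_zero hc

theorem eq_smul_Estar (hk2 : Even k) (hk : k = 0 ∨ 4 ≤ k) (hk6 : k ≤ 6) (hf : f ∈ M k 3) :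
    f = (qExpansion 1 f).coeff 0 • Estar k 3 := by
  have hE := Estar_mem_M (p := 3) hk2 hk
  rw [← sub_eq_zero]
  refine eq_zero_of_coeff_zero_of_le_six hk6 ((M k 3).sub_mem hf ((M k 3).smul_mem _ hE)) ?_
  rw [qExpansion_sub_of_mem_M hf ((M k 3).smul_mem _ hE), qExpansion_smul_of_mem_M hE, map_sub,
    PowerSeries.coeff_smul, Estar_qExpansion_coeff_zero hk2 hk, smul_eq_mul, mul_one, sub_self]

theorem Estar_four_mem_M : Estar 4 3 ∈ M 4 3 := Estar_mem_M (by decide) (by decide)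
theorem Estar_six_mem_M : Estar 6 3 ∈ M 6 3 := Estar_mem_M (by decide) (by decide)
theorem Estar_eight_mem_M : Estar 8 3 ∈ M 8 3 := Estar_mem_M (by decide) (by decide)
theorem Estar_ten_mem_M : Estar 10 3 ∈ M 10 3 := Estar_mem_M (by decide) (by decide)

theorem Estar_four_coeff_zero : (qExpansion 1 (Estar 4 3)).coeff 0 = 1 :=
  Estar_qExpansion_coeff_zero (by decide) (by decide)
theorem Estar_six_coeff_zero : (qExpansion 1 (Estar 6 3)).coeff 0 = 1 :=
  Estar_qExpansion_coeff_zero (by decide) (by decide)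
theorem Estar_eight_coeff_zero : (qExpansion 1 (Estar 8 3)).coeff 0 = 1 :=
  Estar_qExpansion_coeff_zero (by decide) (by decide)
theorem Estar_ten_coeff_zero : (qExpansion 1 (Estar 10 3)).coeff 0 = 1 :=
  Estar_qExpansion_coeff_zero (by decide) (by decide)

theorem eq_zero_of_weight_two (hf : f ∈ M 2 3) : f = 0 := by
  have hf2 : f * f ∈ M 4 3 := mul_mem_M hf hf rfl
  have hf3 : f * f * f ∈ M 6 3 := mul_mem_M hf2 hf rfl
  have e4 := congrArg (fun f ↦ (qExpansion 1 f).coeff 1)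
    (eq_smul_Estar (by decide) (by decide) (by decide) hf2)
  have e6 := congrArg (fun f ↦ (qExpansion 1 f).coeff 1)
    (eq_smul_Estar (by decide) (by decide) (by decide) hf3)
  simp only [qExpansion_smul_of_mem_M Estar_four_mem_M, qExpansion_smul_of_mem_M Estar_six_mem_M,
    qExpansion_mul_coeff_zero_of_mem_M hf hf, qExpansion_mul_coeff_zero_of_mem_M hf2 hf,
    qExpansion_mul_coeff_one_of_mem_M hf hf, qExpansion_mul_coeff_one_of_mem_M hf2 hf,
    PowerSeries.coeff_smul, Estar_four_coeff_one, Estar_six_coeff_one, smul_eq_mul] at e4 e6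
  refine eq_zero_of_coeff_zero_of_le_six (by norm_num) hf ?_
  generalize (qExpansion 1 f).coeff 0 = a at *
  generalize (qExpansion 1 f).coeff 1 = b at *
  -- For f = a + bq + ⋯, f² = a²E₄* gives 2ab = 24a² and f³ = a³E₆* gives 3a²b = -18a³; eliminating
  -- b leaves 54a³ = 0.
  have h : a ^ 3 = 0 := by linear_combination (1 / 54 : ℂ) * e6 - (1 / 36 : ℂ) * a * e4
  exact eq_zero_of_pow_eq_zero h

/-! ### The forms of weights 8 and 10, and the zero-free form `Delta12_0`. -/

theorem Delta8_mem_M : Delta8 ∈ M 8 3 :=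
  Submodule.smul_mem _ _ <| Submodule.sub_mem _ (pow_mem_M Estar_four_mem_M 2 rfl) Estar_eight_mem_M

theorem Delta10_mem_M : Delta10 ∈ M 10 3 :=
  Submodule.smul_mem _ _ <| Submodule.sub_mem _
    (mul_mem_M Estar_four_mem_M Estar_six_mem_M rfl) Estar_ten_mem_M

theorem Delta8_coeff (n : ℕ) : (qExpansion 1 Delta8).coeff n =
    41 / 1728 * ((qExpansion 1 (Estar 4 3 * Estar 4 3)).coeff n -
      (qExpansion 1 (Estar 8 3)).coeff n) := by
  have h : Estar 4 3 * Estar 4 3 ∈ M 8 3 := mul_mem_M Estar_four_mem_M Estar_four_mem_M rfl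
  rw [Delta8, pow_two, qExpansion_smul_of_mem_M (Submodule.sub_mem _ h Estar_eight_mem_M),
    qExpansion_sub_of_mem_M h Estar_eight_mem_M, PowerSeries.coeff_smul, map_sub, smul_eq_mul]

theorem Delta8_coeff_zero : (qExpansion 1 Delta8).coeff 0 = 0 := by
  rw [Delta8_coeff, qExpansion_mul_coeff_zero_of_mem_M Estar_four_mem_M Estar_four_mem_M,
    Estar_four_coeff_zero, Estar_eight_coeff_zero]
  norm_num

theorem Delta8_coeff_one : (qExpansion 1 Delta8).coeff 1 = 1 := by
  rw [Delta8_coeff, qExpansion_mul_coeff_one_of_mem_M Estar_four_mem_M Estar_four_mem_M,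
    Estar_four_coeff_zero, Estar_four_coeff_one, Estar_eight_coeff_one]
  norm_num

theorem Delta8_coeff_two : (qExpansion 1 Delta8).coeff 2 = 6 := by
  rw [Delta8_coeff, qExpansion_mul_coeff_two_of_mem_M Estar_four_mem_M Estar_four_mem_M,
    Estar_four_coeff_zero, Estar_four_coeff_one, Estar_four_coeff_two, Estar_eight_coeff_two]
  norm_num

theorem Delta10_coeff (n : ℕ) : (qExpansion 1 Delta10).coeff n =
    61 / 432 * ((qExpansion 1 (Estar 4 3 * Estar 6 3)).coeff n -
      (qExpansion 1 (Estar 10 3)).coeff n) := by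
  have h : Estar 4 3 * Estar 6 3 ∈ M 10 3 := mul_mem_M Estar_four_mem_M Estar_six_mem_M rfl
  rw [Delta10, qExpansion_smul_of_mem_M (Submodule.sub_mem _ h Estar_ten_mem_M),
    qExpansion_sub_of_mem_M h Estar_ten_mem_M, PowerSeries.coeff_smul, map_sub, smul_eq_mul]

theorem Delta10_coeff_zero : (qExpansion 1 Delta10).coeff 0 = 0 := by
  rw [Delta10_coeff, qExpansion_mul_coeff_zero_of_mem_M Estar_four_mem_M Estar_six_mem_M,
    Estar_four_coeff_zero, Estar_six_coeff_zero, Estar_ten_coeff_zero]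
  norm_num

theorem Delta10_coeff_one : (qExpansion 1 Delta10).coeff 1 = 1 := by
  rw [Delta10_coeff, qExpansion_mul_coeff_one_of_mem_M Estar_four_mem_M Estar_six_mem_M,
    Estar_four_coeff_zero, Estar_four_coeff_one, Estar_six_coeff_zero, Estar_six_coeff_one,
    Estar_ten_coeff_one]
  norm_num

/-- Δ₈⁴ / `discMul` and (E₄*)² both have weight 8, where a form is determined by its first two
coefficients. The quotient begins (1 + 6q)⁴ / (1 - 24q) = 1 + 48q + ⋯, as does (1 + 24q)². -/
theorem Delta8_pow_four : Delta8 ^ 4 = Estar 4 3 ^ 2 * discMul := by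
  have hE2 : Estar 4 3 * Estar 4 3 ∈ M 8 3 := mul_mem_M Estar_four_mem_M Estar_four_mem_M rfl
  have hP : Delta8 ^ 4 / discMul ∈ M 8 3 :=
    pow_four_div_discMul_mem_M Delta8_mem_M Delta8_coeff_zero
  have hmul : Delta8 ^ 4 = discMul * (Delta8 ^ 4 / discMul) := by
    ext z
    simp [mul_div_cancel₀ _ (discMul_ne_zero z)]
  obtain ⟨A, hA⟩ : PowerSeries.X ∣ qExpansion 1 Delta8 :=
    PowerSeries.X_dvd_iff.mpr (by simpa using Delta8_coeff_zero)
  obtain ⟨B, hB, hB0, hB1⟩ := exists_qExpansion_discMul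
  have hA0 : A.coeff 0 = 1 := by
    rw [← Delta8_coeff_one, hA, ← PowerSeries.coeff_succ_X_mul]
  have hA1 : A.coeff 1 = 6 := by
    rw [← Delta8_coeff_two, hA, ← PowerSeries.coeff_succ_X_mul]
  have hq : A * A * (A * A) = B * qExpansion 1 (Delta8 ^ 4 / discMul) := by
    have h := congrArg (qExpansion 1) hmul
    rw [qExpansion_pow_of_mem_M Delta8_mem_M, qExpansion_mul_of_mem_M discMul_mem_M hP, hA, hB,
      mul_pow, mul_assoc] at h
    rw [← mul_left_cancel₀ (pow_ne_zero 4 PowerSeries.X_ne_zero) h]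
    ring
  have hq0 := congrArg (PowerSeries.coeff 0) hq
  have hq1 := congrArg (PowerSeries.coeff 1) hq
  simp only [PowerSeries.coeff_mul, Finset.Nat.antidiagonal_succ, Finset.Nat.antidiagonal_zero,
    Finset.map_singleton, Finset.sum_singleton, Finset.sum_cons, Function.Embedding.prodMap,
    Function.Embedding.coeFn_mk, Prod.map, Function.Embedding.refl_apply, hA0, hA1, hB0, hB1]
    at hq0 hq1
  have h : Delta8 ^ 4 / discMul - Estar 4 3 * Estar 4 3 = 0 := by
    refine eq_zero_of_coeff_eq_zero_of_lt_twelve (by norm_num) (Submodule.sub_mem _ hP hE2) ?_ ?_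
    · rw [qExpansion_sub_of_mem_M hP hE2, map_sub,
        qExpansion_mul_coeff_zero_of_mem_M Estar_four_mem_M Estar_four_mem_M,
        Estar_four_coeff_zero]
      linear_combination -hq0
    · rw [qExpansion_sub_of_mem_M hP hE2, map_sub,
        qExpansion_mul_coeff_one_of_mem_M Estar_four_mem_M Estar_four_mem_M,
        Estar_four_coeff_zero, Estar_four_coeff_one]
      simp at hq0 hq1 ⊢
      linear_combination -hq1 - 24 * hq0
  rw [hmul, sub_eq_zero.mp h]
  ring

/-- The function `(η(3z) η(z))^12`, a square root of `Δ(3z) Δ(z)`. -/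
def etaMulPow : ℍ → ℂ := fun z ↦ (eta (scale 3 z) * eta z) ^ 12

theorem etaMulPow_sq : etaMulPow ^ 2 = discMul := by
  ext z
  simp only [Pi.pow_apply, etaMulPow, discMul, Pi.mul_apply, Function.comp_apply, discriminant]
  ring

theorem mdifferentiable_eta : MDiff (fun z : ℍ ↦ eta z) := by
  rw [UpperHalfPlane.mdifferentiable_iff]
  refine DifferentiableOn.congr (f := eta) (fun z hz ↦
    (differentiableAt_eta_of_mem_upperHalfPlaneSet hz).differentiableWithinAt) fun z hz ↦ ?_
  simp [ofComplex_apply_of_im_pos hz]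

theorem mdifferentiable_etaMulPow : MDiff etaMulPow :=
  ((mdifferentiable_comp_scale (p := 3) mdifferentiable_eta).mul mdifferentiable_eta).pow 12

/-- By `Delta8_pow_four`, Δ₈² and E₄* `etaMulPow` have equal squares. Holomorphic functions on ℍ
form a domain, so they agree up to a global sign, which D absorbs. -/
theorem exists_Estar_four_mul_eq : ∃ D : ℍ → ℂ,
    MDiff D ∧ D ^ 2 = discMul ∧ Estar 4 3 * D = Delta8 ^ 2 := by
  have hE := mdifferentiable_of_mem_M Estar_four_mem_M
  have h8 := mdifferentiable_of_mem_M (pow_mem_M Delta8_mem_M 2 rfl)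
  have hEη := hE.mul mdifferentiable_etaMulPow
  have h : (Delta8 ^ 2 - Estar 4 3 * etaMulPow) * (Delta8 ^ 2 + Estar 4 3 * etaMulPow) = 0 := by
    linear_combination Delta8_pow_four - Estar 4 3 ^ 2 * etaMulPow_sq
  rcases (mul_eq_zero_iff (h8.sub hEη) (h8.add hEη)).mp h with h | h
  · exact ⟨etaMulPow, mdifferentiable_etaMulPow, etaMulPow_sq, by linear_combination -h⟩
  · exact ⟨-etaMulPow, mdifferentiable_etaMulPow.neg, by rw [neg_sq, etaMulPow_sq],
      by linear_combination -h⟩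

theorem Delta12_0_eq {D : ℍ → ℂ} (hD : MDiff D) (h : Estar 4 3 * D = Delta8 ^ 2) :
    Delta12_0 = D := by
  ext z
  -- The zeros of E₄* are isolated, so near z the quotient agrees with D off z, and its punctured
  -- limit is D z by continuity.
  have hne : ∀ᶠ w in 𝓝[≠] z, Estar 4 3 w ≠ 0 := by
    by_contra hc
    exact Estar_ne_zero (k := 4) (p := 3) (by decide) (by decide)
      (eq_zero_of_frequently (mdifferentiable_of_mem_M Estar_four_mem_M)
        (τ := z) hc)
  refine Tendsto.limUnder_eq ?_
  refine (hD.continuous.continuousAt.tendsto.mono_left nhdsWithin_le_nhds).congr' ?_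
  filter_upwards [hne] with w hw
  rw [eq_div_iff hw, mul_comm]
  exact congrFun h w

theorem mdifferentiable_Delta12_0 : MDiff Delta12_0 := by
  obtain ⟨D, hD, -, h⟩ := exists_Estar_four_mul_eq
  rwa [Delta12_0_eq hD h]

theorem Delta12_0_sq : Delta12_0 ^ 2 = discMul := by
  obtain ⟨D, hD, h2, h⟩ := exists_Estar_four_mul_eq
  rwa [Delta12_0_eq hD h]

theorem Estar_four_mul_Delta12_0 : Estar 4 3 * Delta12_0 = Delta8 ^ 2 := by
  obtain ⟨D, hD, h2, h⟩ := exists_Estar_four_mul_eq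
  rwa [Delta12_0_eq hD h]

theorem Delta12_0_apply_ne_zero (z : ℍ) : Delta12_0 z ≠ 0 := by
  have h := congrFun Delta12_0_sq z
  intro h0
  rw [Pi.pow_apply, h0] at h
  exact discMul_ne_zero z (by rw [← h]; norm_num)

theorem mdifferentiable_slash {p : ℕ} [NeZero p] (hf : MDiff f) {g : GL (Fin 2) ℝ}
    (hg : g ∈ Gamma0Star p) (k : ℤ) : MDiff (f ∣[k] g) := by
  have hdet : 0 < g.det.val := by
    rw [Subgroup.HasDetOne.det_eq hg]
    exact one_pos
  have : f ∣[k] g = (fun z : ℍ ↦ f (g • z)) * fun z : ℍ ↦ denom g z ^ (-k) := by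
    ext z
    rw [slash_apply_of_mem hg, Pi.mul_apply]
  rw [this]
  exact (hf.comp (mdifferentiable_smul hdet)).mul (mdifferentiable_denom_zpow g _)

theorem Delta12_0_mem_M : Delta12_0 ∈ M 12 3 := by
  refine mem_M_iff.mpr ⟨mdifferentiable_Delta12_0, fun g hg ↦ ?_, ?_⟩
  · have hE := mem_M_iff.mp Estar_four_mem_M
    have h8 : Delta8 ^ 2 ∈ M (4 + 12) 3 := pow_mem_M Delta8_mem_M 2 rfl
    have h := (mem_M_iff.mp h8).2.1 g hg
    rw [← Estar_four_mul_Delta12_0, slash_mul_of_mem hg, hE.2.1 g hg] at h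
    -- Invariance of the product Δ₈² and of E₄* passes to the other factor, because the nonzero
    -- holomorphic E₄* can be cancelled.
    have hs : Estar 4 3 * (Delta12_0 ∣[(12 : ℤ)] g - Delta12_0) = 0 := by
      rw [mul_sub, h, sub_self]
    refine sub_eq_zero.mp (((mul_eq_zero_iff hE.1 ((mdifferentiable_slash
      mdifferentiable_Delta12_0 hg 12).sub mdifferentiable_Delta12_0)).mp hs).resolve_left ?_)
    exact Estar_ne_zero (by decide) (by decide)
  -- The square of `Delta12_0` is `discMul`, which is bounded at infinity.
  · refine Asymptotics.IsBigO.of_pow two_ne_zero ?_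
    rw [Delta12_0_sq, one_pow]
    exact (mem_M_iff.mp discMul_mem_M).2.2

theorem Delta12_0_coeff : (qExpansion 1 Delta12_0).coeff 0 = 0 ∧
    (qExpansion 1 Delta12_0).coeff 1 = 0 ∧ (qExpansion 1 Delta12_0).coeff 2 = 1 := by
  have hq := congrArg (qExpansion 1) Estar_four_mul_Delta12_0
  rw [pow_two] at hq
  have h0 := congrArg (PowerSeries.coeff 0) hq
  have h1 := congrArg (PowerSeries.coeff 1) hq
  have h2 := congrArg (PowerSeries.coeff 2) hq
  rw [qExpansion_mul_coeff_zero_of_mem_M Estar_four_mem_M Delta12_0_mem_M,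
    qExpansion_mul_coeff_zero_of_mem_M Delta8_mem_M Delta8_mem_M, Delta8_coeff_zero,
    Estar_four_coeff_zero, one_mul, zero_mul] at h0
  rw [qExpansion_mul_coeff_one_of_mem_M Estar_four_mem_M Delta12_0_mem_M,
    qExpansion_mul_coeff_one_of_mem_M Delta8_mem_M Delta8_mem_M, Delta8_coeff_zero,
    Estar_four_coeff_zero, h0, one_mul, zero_mul, mul_zero, mul_zero, add_zero, add_zero] at h1
  rw [qExpansion_mul_coeff_two_of_mem_M Estar_four_mem_M Delta12_0_mem_M,
    qExpansion_mul_coeff_two_of_mem_M Delta8_mem_M Delta8_mem_M, Delta8_coeff_zero,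
    Delta8_coeff_one, Estar_four_coeff_zero, h0, h1] at h2
  refine ⟨h0, h1, ?_⟩
  linear_combination h2

/-! ### Division by `Delta12_0` and the cusp spaces. -/

theorem exists_eq_Delta12_0_mul (hf : f ∈ M k 3) (h0 : (qExpansion 1 f).coeff 0 = 0)
    (h1 : (qExpansion 1 f).coeff 1 = 0) : ∃ g ∈ M (k - 12) 3, f = Delta12_0 * g := by
  obtain ⟨d0, d1, d2⟩ := Delta12_0_coeff
  refine ⟨f / Delta12_0, div_mem_M (n := 2) hf Delta12_0_mem_M Delta12_0_apply_ne_zero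
    (fun i hi ↦ by interval_cases i <;> assumption)
    (fun i hi ↦ by interval_cases i <;> assumption) (by rw [d2]; exact one_ne_zero), ?_⟩
  ext z
  rw [Pi.mul_apply, Pi.div_apply, mul_div_cancel₀ _ (Delta12_0_apply_ne_zero z)]

theorem exists_eq_smul_add (hf : f ∈ M k 3) {v : ℍ → ℂ} (hv : v ∈ M k 3)
    (h0 : (qExpansion 1 f).coeff 0 = 0) (hv0 : (qExpansion 1 v).coeff 0 = 0)
    (hv1 : (qExpansion 1 v).coeff 1 = 1) :
    ∃ (c : ℂ), ∃ g ∈ M (k - 12) 3, f = c • v + Delta12_0 * g := by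
  have hcv := (M k 3).smul_mem ((qExpansion 1 f).coeff 1) hv
  obtain ⟨g, hg, h⟩ := exists_eq_Delta12_0_mul ((M k 3).sub_mem hf hcv)
    (by rw [qExpansion_sub_of_mem_M hf hcv, qExpansion_smul_of_mem_M hv, map_sub,
      PowerSeries.coeff_smul, h0, hv0, smul_zero, sub_zero])
    (by rw [qExpansion_sub_of_mem_M hf hcv, qExpansion_smul_of_mem_M hv, map_sub,
      PowerSeries.coeff_smul, hv1, smul_eq_mul, mul_one, sub_self])
  exact ⟨_, g, hg, by rw [← h]; ring⟩

/-- After subtracting a multiple of v, a cusp form is `Delta12_0` times a form of weight k - 12,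
hence 0. This serves weights 8 and 10 (negative k - 12) and 14 (where k - 12 = 2). -/
theorem M0_eq_span {v : ℍ → ℂ} (hv : v ∈ M k 3) (hv0 : (qExpansion 1 v).coeff 0 = 0)
    (hv1 : (qExpansion 1 v).coeff 1 = 1) (hk : M (k - 12) 3 = ⊥) :
    v ≠ 0 ∧ M0 k 3 = Submodule.span ℂ {v} := by
  refine ⟨?_, le_antisymm (fun f hf ↦ ?_) ?_⟩
  · rintro rfl
    rw [qExpansion_zero] at hv1
    simp at hv1
  · obtain ⟨hf, h0⟩ := mem_M0_iff_coeff.mp hf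
    obtain ⟨c, g, hg, rfl⟩ := exists_eq_smul_add hf hv h0 hv0 hv1
    rw [hk, Submodule.mem_bot] at hg
    rw [hg, mul_zero, add_zero]
    exact Submodule.smul_mem _ _ (Submodule.mem_span_singleton_self v)
  · rw [Submodule.span_singleton_le_iff_mem]
    exact mem_M0_iff_coeff.mpr ⟨hv, hv0⟩

theorem M_eq_bot_of_neg (hk : k < 0) : M k 3 = ⊥ :=
  (Submodule.eq_bot_iff _).mpr fun _ hf ↦ eq_zero_of_neg_weight hk hf

theorem M_two_eq_bot : M 2 3 = ⊥ :=
  (Submodule.eq_bot_iff _).mpr fun _ hf ↦ eq_zero_of_weight_two hf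

theorem M0_eq_bot_of_le_six (hk : k ≤ 6) : M0 k 3 = ⊥ :=
  (Submodule.eq_bot_iff _).mpr fun _ hf ↦
    eq_zero_of_coeff_zero_of_le_six hk (mem_M0_iff_coeff.mp hf).1 (mem_M0_iff_coeff.mp hf).2

theorem M_eq_span_Estar (hk2 : Even k) (hk : k = 0 ∨ 4 ≤ k) (hk6 : k ≤ 6) :
    M k 3 = Submodule.span ℂ {Estar k 3} := by
  refine le_antisymm (fun f hf ↦ ?_) ?_
  · rw [eq_smul_Estar hk2 hk hk6 hf]
    exact Submodule.smul_mem _ _ (Submodule.mem_span_singleton_self _)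
  · rw [Submodule.span_singleton_le_iff_mem]
    exact Estar_mem_M hk2 hk

theorem Delta12_1_mem_M : Delta12_1 ∈ M 12 3 := mul_mem_M Delta8_mem_M Estar_four_mem_M rfl

theorem Delta12_1_coeff_zero : (qExpansion 1 Delta12_1).coeff 0 = 0 := by
  rw [Delta12_1, qExpansion_mul_coeff_zero_of_mem_M Delta8_mem_M Estar_four_mem_M,
    Delta8_coeff_zero, zero_mul]

theorem Delta12_1_coeff_one : (qExpansion 1 Delta12_1).coeff 1 = 1 := by
  rw [Delta12_1, qExpansion_mul_coeff_one_of_mem_M Delta8_mem_M Estar_four_mem_M,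
    Delta8_coeff_zero, Delta8_coeff_one, Estar_four_coeff_zero, zero_mul, zero_add, mul_one]

theorem Delta14_mem_M : Delta14 ∈ M 14 3 := mul_mem_M Delta10_mem_M Estar_four_mem_M rfl

theorem Delta14_coeff_zero : (qExpansion 1 Delta14).coeff 0 = 0 := by
  rw [Delta14, qExpansion_mul_coeff_zero_of_mem_M Delta10_mem_M Estar_four_mem_M,
    Delta10_coeff_zero, zero_mul]

theorem Delta14_coeff_one : (qExpansion 1 Delta14).coeff 1 = 1 := by
  rw [Delta14, qExpansion_mul_coeff_one_of_mem_M Delta10_mem_M Estar_four_mem_M,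
    Delta10_coeff_zero, Delta10_coeff_one, Estar_four_coeff_zero, zero_mul, zero_add, mul_one]

theorem mul_Estar_coeff {l : ℤ} {u : ℍ → ℂ} (hu : u ∈ M l 3) (hu0 : (qExpansion 1 u).coeff 0 = 0)
    (hu1 : (qExpansion 1 u).coeff 1 = 1) (hk2 : Even k) (hk : k = 0 ∨ 4 ≤ k) :
    (qExpansion 1 (u * Estar k 3)).coeff 0 = 0 ∧ (qExpansion 1 (u * Estar k 3)).coeff 1 = 1 := by
  have hE := Estar_mem_M (p := 3) hk2 hk
  rw [qExpansion_mul_coeff_zero_of_mem_M hu hE, qExpansion_mul_coeff_one_of_mem_M hu hE, hu0, hu1,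
    Estar_qExpansion_coeff_zero hk2 hk]
  simp

theorem exists_mem_M_coeff_one (hk2 : Even k) (hk : 8 ≤ k) : ∃ v ∈ M k 3,
    (qExpansion 1 v).coeff 0 = 0 ∧ (qExpansion 1 v).coeff 1 = 1 := by
  -- Multiplying `Delta8` by E*_{k-8} fails only for k - 8 = 2, so weight 10 uses `Delta10`.
  by_cases h : k = 10
  · subst h
    exact ⟨_, Delta10_mem_M, Delta10_coeff_zero, Delta10_coeff_one⟩
  · have h2 : Even (k - 8) := hk2.sub (by decide)
    have h4 : k - 8 = 0 ∨ 4 ≤ k - 8 := by grind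
    exact ⟨Delta8 * Estar (k - 8) 3, mul_mem_M Delta8_mem_M (Estar_mem_M h2 h4) (by ring),
      mul_Estar_coeff Delta8_mem_M Delta8_coeff_zero Delta8_coeff_one h2 h4⟩

theorem linearIndependent_Delta12 : LinearIndependent ℂ ![Delta12_0, Delta12_1] := by
  rw [LinearIndependent.pair_iff]
  intro s t h
  have hs := Submodule.smul_mem _ s Delta12_0_mem_M
  have ht := Submodule.smul_mem _ t Delta12_1_mem_M
  have hq := congrArg (fun f ↦ (qExpansion 1 f).coeff 1) h
  simp only [qExpansion_add (analyticAt_cuspFunction_of_mem_M hs)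
    (analyticAt_cuspFunction_of_mem_M ht), qExpansion_smul_of_mem_M Delta12_0_mem_M,
    qExpansion_smul_of_mem_M Delta12_1_mem_M, map_add, PowerSeries.coeff_smul, Delta12_0_coeff.2.1,
    Delta12_1_coeff_one, qExpansion_zero, smul_eq_mul, mul_zero, mul_one, zero_add, map_zero] at hq
  rw [hq, zero_smul, add_zero] at h
  have hz := congrFun h I
  simp only [Pi.smul_apply, smul_eq_mul, Pi.zero_apply, mul_eq_zero, Delta12_0_apply_ne_zero,
    or_false] at hz
  exact ⟨hz, hq⟩

theorem Delta12_0_mem_M0 : Delta12_0 ∈ M0 12 3 :=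
  mem_M0_iff_coeff.mpr ⟨Delta12_0_mem_M, Delta12_0_coeff.1⟩

theorem Delta12_1_mem_M0 : Delta12_1 ∈ M0 12 3 :=
  mem_M0_iff_coeff.mpr ⟨Delta12_1_mem_M, Delta12_1_coeff_zero⟩

theorem M0_twelve_eq_span : M0 12 3 = Submodule.span ℂ {Delta12_0, Delta12_1} := by
  refine le_antisymm (fun f hf ↦ ?_) ?_
  · obtain ⟨hf, h0⟩ := mem_M0_iff_coeff.mp hf
    obtain ⟨c, g, hg, rfl⟩ := exists_eq_smul_add hf Delta12_1_mem_M h0 Delta12_1_coeff_zero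
      Delta12_1_coeff_one
    obtain ⟨a, rfl⟩ := eq_const_of_weight_zero (p := 3) (show g ∈ M 0 3 from hg)
    exact Submodule.mem_span_pair.mpr ⟨a, c, by rw [mul_smul_comm, mul_one, add_comm]⟩
  · rw [Submodule.span_le]
    rintro f (rfl | rfl)
    · exact Delta12_0_mem_M0
    · exact Delta12_1_mem_M0

theorem M0_eq_mul (hk2 : Even k) (h8 : k ≠ 8) (h10 : k ≠ 10) (h14 : k ≠ 14) :
    M0 k 3 = M0 12 3 * M (k - 12) 3 := by
  by_cases hk6 : k ≤ 6
  · rw [M0_eq_bot_of_le_six hk6, M_eq_bot_of_neg (show k - 12 < 0 by omega), Submodule.mul_bot]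
  have h2 : Even (k - 12) := hk2.sub (by decide)
  -- The exclusions of 8, 10 and 14 are exactly what makes E*_{k-12} available, so that
  -- Δ¹₁₂E*_{k-12} is a product starting with q.
  have h4 : k - 12 = 0 ∨ 4 ≤ k - 12 := by grind
  refine le_antisymm (fun f hf ↦ ?_) (Submodule.mul_le.mpr fun f hf g hg ↦ ?_)
  · obtain ⟨hf, h0⟩ := mem_M0_iff_coeff.mp hf
    have hE := Estar_mem_M (p := 3) h2 h4
    obtain ⟨hv0, hv1⟩ := mul_Estar_coeff Delta12_1_mem_M Delta12_1_coeff_zero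
      Delta12_1_coeff_one h2 h4
    obtain ⟨c, g, hg, rfl⟩ := exists_eq_smul_add hf
      (mul_mem_M Delta12_1_mem_M hE (by ring)) h0 hv0 hv1
    exact Submodule.add_mem _
      (Submodule.smul_mem _ _ (Submodule.mul_mem_mul Delta12_1_mem_M0 hE))
      (Submodule.mul_mem_mul Delta12_0_mem_M0 hg)
  · obtain ⟨hf, h0⟩ := mem_M0_iff_coeff.mp hf
    exact mem_M0_iff_coeff.mpr ⟨mul_mem_M hf hg (by ring), by
      rw [qExpansion_mul_coeff_zero_of_mem_M hf hg, h0, zero_mul]⟩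

/-! ### The dimension formula. -/

theorem nonempty_linearEquiv_M (hk2 : Even k) (hk : 8 ≤ k) :
    Nonempty (((ℂ × ℂ) × M (k - 12) 3) ≃ₗ[ℂ] M k 3) := by
  obtain ⟨v, hv, hv0, hv1⟩ := exists_mem_M_coeff_one hk2 hk
  have hu := Estar_mem_M (p := 3) hk2 (Or.inr (by omega))
  have hu0 := Estar_qExpansion_coeff_zero (p := 3) hk2 (Or.inr (by omega))
  set u := Estar k 3
  have hD : ∀ g ∈ M (k - 12) 3, Delta12_0 * g ∈ M k 3 := fun g hg ↦
    mul_mem_M Delta12_0_mem_M hg (by ring)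
  -- u starts with 1, v with q, and `Delta12_0` * g has order at least 2, so the coefficients are
  -- recovered one after the other.
  let L : ((ℂ × ℂ) × M (k - 12) 3) →ₗ[ℂ] M k 3 :=
    { toFun x := ⟨x.1.1 • u + x.1.2 • v + Delta12_0 * x.2, Submodule.add_mem _ (Submodule.add_mem _
        (Submodule.smul_mem _ _ hu) (Submodule.smul_mem _ _ hv)) (hD _ x.2.2)⟩
      map_add' x y := by
        ext z
        simp
        ring
      map_smul' c x := by
        ext z
        simp
        ring }
  refine ⟨LinearEquiv.ofBijective L ⟨?_, ?_⟩⟩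
  · rw [injective_iff_map_eq_zero]
    rintro ⟨⟨a, b⟩, g, hg⟩ h
    have h : a • u + b • v + Delta12_0 * g = 0 := congrArg Subtype.val h
    have ha := Submodule.smul_mem _ a hu
    have hb := Submodule.smul_mem _ b hv
    have hq := congrArg (qExpansion 1) h
    rw [qExpansion_add (analyticAt_cuspFunction_of_mem_M (Submodule.add_mem _ ha hb))
      (analyticAt_cuspFunction_of_mem_M (hD g hg)),
      qExpansion_add (analyticAt_cuspFunction_of_mem_M ha) (analyticAt_cuspFunction_of_mem_M hb),
      qExpansion_smul_of_mem_M hu, qExpansion_smul_of_mem_M hv, qExpansion_zero] at hq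
    have h0 := congrArg (PowerSeries.coeff 0) hq
    simp only [map_add, PowerSeries.coeff_smul, hu0, hv0, smul_eq_mul, map_zero,
      qExpansion_mul_coeff_zero_of_mem_M Delta12_0_mem_M hg, Delta12_0_coeff.1, mul_one, mul_zero,
      zero_mul, add_zero] at h0
    subst h0
    have h1 := congrArg (PowerSeries.coeff 1) hq
    simp only [map_add, PowerSeries.coeff_smul, hv1, smul_eq_mul, map_zero,
      qExpansion_mul_coeff_one_of_mem_M Delta12_0_mem_M hg, Delta12_0_coeff.1,
      Delta12_0_coeff.2.1, mul_one, zero_mul, add_zero, zero_add] at h1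
    subst h1
    have hg0 : g = 0 := by
      ext z
      have hz := congrFun h z
      simpa [Delta12_0_apply_ne_zero] using hz
    subst hg0
    rfl
  · rintro ⟨f, hf⟩
    have hcu := (M k 3).smul_mem ((qExpansion 1 f).coeff 0) hu
    obtain ⟨c, g, hg, h⟩ := exists_eq_smul_add ((M k 3).sub_mem hf hcu) hv
      (by rw [qExpansion_sub_of_mem_M hf hcu, qExpansion_smul_of_mem_M hu, map_sub,
        PowerSeries.coeff_smul, hu0, smul_eq_mul, mul_one, sub_self]) hv0 hv1
    refine ⟨⟨⟨(qExpansion 1 f).coeff 0, c⟩, ⟨g, hg⟩⟩, Subtype.ext ?_⟩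
    change (qExpansion 1 f).coeff 0 • u + c • v + Delta12_0 * g = f
    rw [add_assoc, ← h]
    ring

theorem finite_and_finrank_M (k : ℕ) (hk2 : Even k) : Module.Finite ℂ (M k 3) ∧
    Module.finrank ℂ (M k 3) = if k % 12 = 2 ∨ k % 12 = 6 then k / 6 else k / 6 + 1 := by
  induction k using Nat.strong_induction_on with | _ k ih =>
  by_cases hk : 8 ≤ k
  · obtain ⟨e⟩ := nonempty_linearEquiv_M (k := k) (by exact_mod_cast hk2) (by exact_mod_cast hk)
    have key : Module.Finite ℂ (M ((k : ℤ) - 12) 3) ∧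
        2 + Module.finrank ℂ (M ((k : ℤ) - 12) 3) =
          if k % 12 = 2 ∨ k % 12 = 6 then k / 6 else k / 6 + 1 := by
      by_cases h12 : k < 12
      · rw [M_eq_bot_of_neg (by omega)]
        have : k = 8 ∨ k = 10 := by grind
        refine ⟨inferInstance, ?_⟩
        rw [finrank_bot]
        rcases this with rfl | rfl <;> rfl
      · rw [show (k : ℤ) - 12 = ((k - 12 : ℕ) : ℤ) by omega]
        obtain ⟨h1, h2⟩ := ih (k - 12) (by omega) (by grind)
        refine ⟨h1, ?_⟩
        -- Passing from k - 12 to k keeps the residue class and adds 2 to the quotient by 6,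
        -- matching the two lines spanned by u and v.
        rw [h2, show (k - 12) % 12 = k % 12 by omega, show k / 6 = (k - 12) / 6 + 2 by omega]
        split_ifs <;> omega
    obtain ⟨hfin, hrank⟩ := key
    refine ⟨Module.Finite.equiv e, ?_⟩
    rw [← e.finrank_eq, Module.finrank_prod, Module.finrank_prod, Module.finrank_self, hrank]
  · by_cases h2 : k = 2
    · subst h2
      rw [show ((2 : ℕ) : ℤ) = 2 from rfl, M_two_eq_bot]
      exact ⟨inferInstance, by rw [finrank_bot]; rfl⟩
    · have hk' : (k : ℤ) = 0 ∨ 4 ≤ (k : ℤ) := by grind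
      have hk2' : Even (k : ℤ) := by exact_mod_cast hk2
      rw [M_eq_span_Estar hk2' hk' (by grind), finrank_span_singleton (Estar_ne_zero hk2' hk')]
      have : k = 0 ∨ k = 4 ∨ k = 6 := by grind
      refine ⟨inferInstance, ?_⟩
      rcases this with rfl | rfl | rfl <;> rfl

end LevelThree

end Fricke

end

open Fricke in
theorem mainTheorem6 :
    -- vanishing in negative weight and in weight two
    (∀ k : ℤ, Even k → k < 0 ∨ k = 2 → M k 3 = ⊥) ∧
    -- weights 0, 4, 6
    (∀ k : ℤ, k = 0 ∨ k = 4 ∨ k = 6 →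
      M0 k 3 = ⊥ ∧ Module.finrank ℂ (M k 3) = 1 ∧ Estar k 3 ≠ 0 ∧
        M k 3 = Submodule.span ℂ {Estar k 3}) ∧
    -- weights 8, 10, 14
    (Delta8 ≠ 0 ∧ M0 8 3 = Submodule.span ℂ {Delta8}) ∧
    (Delta10 ≠ 0 ∧ M0 10 3 = Submodule.span ℂ {Delta10}) ∧
    (Delta14 ≠ 0 ∧ M0 14 3 = Submodule.span ℂ {Delta14}) ∧
    -- weight 12; the quotient defining the first generator is exact
    (Estar 4 3 * Delta12_0 = Delta8 ^ 2 ∧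
      LinearIndependent ℂ ![Delta12_0, Delta12_1] ∧
      M0 12 3 = Submodule.span ℂ {Delta12_0, Delta12_1}) ∧
    -- all the other cusp spaces, as linear spans of products
    (∀ k : ℤ, Even k → k ≠ 8 → k ≠ 10 → k ≠ 14 → M0 k 3 = M0 12 3 * M (k - 12) 3) ∧
    -- the dimension formula
    (∀ k : ℕ, Even k → Module.Finite ℂ (M k 3) ∧
      Module.finrank ℂ (M k 3) =
        if k % 12 = 2 ∨ k % 12 = 6 then k / 6 else k / 6 + 1) := by
  refine ⟨?_, fun k hk ↦ ?_, ?_, ?_, ?_,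
    ⟨Estar_four_mul_Delta12_0, linearIndependent_Delta12, M0_twelve_eq_span⟩,
    fun k hk2 h8 h10 h14 ↦ M0_eq_mul hk2 h8 h10 h14, finite_and_finrank_M⟩
  · rintro k - (hk | rfl)
    · exact M_eq_bot_of_neg hk
    · exact M_two_eq_bot
  · have hk2 : Even k := by rcases hk with rfl | rfl | rfl <;> decide
    have hk4 : k = 0 ∨ 4 ≤ k := by omega
    have hk6 : k ≤ 6 := by omega
    have hE : Estar k 3 ≠ 0 := Estar_ne_zero hk2 hk4
    refine ⟨M0_eq_bot_of_le_six hk6, ?_, hE, M_eq_span_Estar hk2 hk4 hk6⟩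
    rw [M_eq_span_Estar hk2 hk4 hk6, finrank_span_singleton hE]
  · exact M0_eq_span Delta8_mem_M Delta8_coeff_zero Delta8_coeff_one (M_eq_bot_of_neg (by decide))
  · exact M0_eq_span Delta10_mem_M Delta10_coeff_zero Delta10_coeff_one
      (M_eq_bot_of_neg (by decide))
  · exact M0_eq_span Delta14_mem_M Delta14_coeff_zero Delta14_coeff_one M_two_eq_bot
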